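/- Let $m\ge 2$ and $n_1,\dots,n_m\ge 1$ be integers. For an array $a=(a_{j_1\cdots j_m})$ $(1\le j_k\le n_k)$ of complex numbers of modulus $1$ put $$s(a)=\sup\Big\{\Big|\sum_{j_1=1}^{n_1}\cdots\sum_{j_m=1}^{n_m}a_{j_1\cdots j_m}x^{(1)}_{j_1}\cdots x^{(m)}_{j_m}\Big| : x^{(k)}_{j}\in\mathbb C,\ |x^{(k)}_{j}|=1\Big\},\qquad S^{\mathbb C}_{n_1\dots n_m}=\min_a s(a),$$ the minimum being over all such arrays $a$. The minimum is attained, and $S^{\mathbb C}_{n_1\dots n_m}$ is also the minimum, over all such arrays $a$, of the norm $\|A\|$ of the $m$-linear form $A:\ell_\infty^{n_1}\times\cdots\times\ell_\infty^{n_m}\to\mathbb C$ with coefficients $a_{j_1\cdots j_m}$. Moreover $$\Big(\frac{\sqrt\pi}{2}\Big)^{m-1}\le\frac{S^{\mathbb C}_{n_1\dots n_m}}{\sqrt{n_1\cdots n_m}\,\max\{\sqrt{n_1},\dots,\sqrt{n_m}\}}\le 1,$$ and the universal upper bound $1$ cannot be improved: for every $m\ge2$, if a real number $C$ is such that the quotient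 above is at most $C$ for all $n_1,\dots,n_m\ge1$, then $C\ge 1$. -/

import Mathlib

namespace SwitchingGame

/-- An `n 0 × ⋯ × n (m-1)` pattern of unit vectors of the plane, i.e. of complex numbers of
modulus one. -/
abbrev Pattern {m : ℕ} (n : Fin m → ℕ) : Type := ((k : Fin m) → Fin (n k)) → Circle

/-- A position of all the knobs: for every direction `k` and every `i : Fin (n k)`, a rotation
of the plane, i.e. multiplication by a complex number of modulus one. -/
abbrev Knobs {m : ℕ} (n : Fin m → ℕ) : Type := (k : Fin m) → Fin (n k) → Circle

/-- The sum of all the vectors of the pattern `a` after the rotations `x`: the vector at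
`j = (j₁, …, jₘ)` is rotated by each of the `m` knobs that act on it. -/
noncomputable def total {m : ℕ} {n : Fin m → ℕ} (a : Pattern n) (x : Knobs n) : ℂ :=
  ∑ j : (k : Fin m) → Fin (n k), (a j : ℂ) * ∏ k, (x k (j k) : ℂ)

/-- `s(Θ)`: the supremum of the Euclidean norms of the sums achievable from a pattern. -/
noncomputable def patternValue {m : ℕ} {n : Fin m → ℕ} (a : Pattern n) : ℝ :=
  ⨆ x : Knobs n, ‖total a x‖

/-- The extremal number `S^ℂ` of the game: the least value of a pattern. -/
noncomputable def gameValue {m : ℕ} (n : Fin m → ℕ) : ℝ :=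
  ⨅ a : Pattern n, patternValue a

/-- The `m`-linear form on `ℓ_∞^{n 0} × ⋯ × ℓ_∞^{n (m-1)}` with the coefficients `a`
(the norm of `Fin (n k) → ℂ` is the sup norm). -/
noncomputable def form {m : ℕ} {n : Fin m → ℕ} (a : Pattern n) :
    ContinuousMultilinearMap ℂ (fun k : Fin m => Fin (n k) → ℂ) ℂ :=
  ∑ j : (k : Fin m) → Fin (n k), (a j : ℂ) •
    (ContinuousMultilinearMap.mkPiAlgebra ℂ (Fin m) ℂ).compContinuousLinearMap
      (fun k => ContinuousLinearMap.proj (R := ℂ) (φ := fun _ : Fin (n k) => ℂ) (j k))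

theorem form_apply {m : ℕ} {n : Fin m → ℕ} (a : Pattern n) (x : (k : Fin m) → Fin (n k) → ℂ) :
    form a x = ∑ j : (k : Fin m) → Fin (n k), (a j : ℂ) * ∏ k, x k (j k) := by
  simp [form]

/-- The normalized extremal number
`S^ℂ / (√(n 0 ⋯ n (m-1)) · max {√(n 0), …, √(n (m-1))})`. -/
noncomputable def ratio {m : ℕ} (n : Fin m → ℕ) : ℝ :=
  gameValue n / (√(∏ k, (n k : ℝ)) * ⨆ k, √(n k : ℝ))

end SwitchingGame

/-!
The lower bound rests on Khinchin's inequality `‖∑ c k z k‖₁ ≥ (√π / 2) ‖c‖₂` for independent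
uniform variables `z k` on the unit circle. For `‖c‖₂ = 1`, integrating `(1 - cos (t x)) / t ^ 2`
in `t` represents the left-hand side as `∫ (1 - ∏ J₀ (t |c k|)) / t ^ 2`. If all `|c k| ^ 2` are at
most `1 / 2`, the inequality of arithmetic and geometric means separates the factors, and it is
enough that `∫ (1 - |J₀| ^ p) / t ^ 2` for `p ≥ 2` is at least the corresponding Gaussian integral.
If one coefficient is large, the average over its phase is bounded below by a quartic polynomial in
the modulus of the remaining sum, whose second and fourth moments are under control.
Khinchin's inequality, used once in each direction but the longest, bounds the `ℓ₁` norm of a vector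
of multilinear forms, and the knobs of the longest direction align the phases of its entries.

For the upper bound, the directions are ordered by decreasing length and consecutive ones are
coupled by Fourier matrices. The slices along the longest direction then have a constant sum of
squared norms, and the Cauchy–Schwarz inequality gives the bound `1`, which is attained when all
lengths are `1`.
-/

namespace SwitchingGame

open Real MeasureTheory

theorem nonneg_of_hasDerivAt_nonneg {f f' : ℝ → ℝ} (hf : ∀ x, HasDerivAt f (f' x) x)
    (hf₀ : f 0 = 0) (hf' : ∀ x, 0 ≤ x → 0 ≤ f' x) {x : ℝ} (hx : 0 ≤ x) : 0 ≤ f x := by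
  have hmono : MonotoneOn f (Set.Ici 0) :=
    monotoneOn_of_hasDerivWithinAt_nonneg (convex_Ici 0)
      (fun y _ => (hf y).continuousAt.continuousWithinAt)
      (fun y _ => (hf y).hasDerivWithinAt) fun y hy => hf' y (interior_subset hy)
  simpa [hf₀] using hmono Set.self_mem_Ici hx hx

theorem hasDerivAt_pow_div_factorial (n : ℕ) (x : ℝ) :
    HasDerivAt (fun x : ℝ => x ^ (n + 1) / (n + 1).factorial) (x ^ n / n.factorial) x := by
  refine ((hasDerivAt_pow (n + 1) x).div_const _).congr_deriv ?_
  have hfact : (n.factorial : ℝ) ≠ 0 := by positivity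
  rw [Nat.factorial_succ, Nat.add_sub_cancel]
  push_cast
  field_simp

/-! ### Bessel functions -/

/-- The Taylor polynomial of the sine at `0` with `n` nonzero terms. -/
noncomputable def sinTaylor (n : ℕ) (x : ℝ) : ℝ :=
  ∑ k ∈ Finset.range n, (-1) ^ k * (x ^ (2 * k + 1) / (2 * k + 1).factorial)

/-- The Taylor polynomial of the cosine at `0` with `n` nonzero terms. -/
noncomputable def cosTaylor (n : ℕ) (x : ℝ) : ℝ :=
  ∑ k ∈ Finset.range n, (-1) ^ k * (x ^ (2 * k) / (2 * k).factorial)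

theorem hasDerivAt_sinTaylor (n : ℕ) (x : ℝ) : HasDerivAt (sinTaylor n) (cosTaylor n x) x :=
  HasDerivAt.fun_sum fun k _ => (hasDerivAt_pow_div_factorial (2 * k) x).const_mul _

theorem hasDerivAt_cosTaylor (n : ℕ) (x : ℝ) :
    HasDerivAt (cosTaylor (n + 1)) (-sinTaylor n x) x := by
  unfold cosTaylor sinTaylor
  simp only [Finset.sum_range_succ' _ n, mul_zero, pow_zero, ← Finset.sum_neg_distrib]
  refine (HasDerivAt.fun_sum fun k _ => ?_).add_const _
  refine ((hasDerivAt_pow_div_factorial (2 * k + 1) x).const_mul ((-1) ^ (k + 1))).congr_deriv ?_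
  ring

theorem sinTaylor_alternating_of_cosTaylor_alternating {n : ℕ}
    (hcos : ∀ x, 0 ≤ x → 0 ≤ (-1) ^ n * (cos x - cosTaylor n x)) {x : ℝ} (hx : 0 ≤ x) :
    0 ≤ (-1) ^ n * (sin x - sinTaylor n x) :=
  nonneg_of_hasDerivAt_nonneg
    (fun y => ((hasDerivAt_sin y).fun_sub (hasDerivAt_sinTaylor n y)).const_mul _)
    (by simp [sinTaylor]) hcos hx

theorem cosTaylor_alternating (n : ℕ) {x : ℝ} (hx : 0 ≤ x) :
    0 ≤ (-1) ^ (n + 1) * (cos x - cosTaylor (n + 1) x) := by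
  induction n generalizing x with
  | zero => simpa [cosTaylor] using cos_le_one x
  | succ n ih =>
    refine nonneg_of_hasDerivAt_nonneg
      (fun y => ((hasDerivAt_cos y).fun_sub (hasDerivAt_cosTaylor (n + 1) y)).const_mul _)
      (by simp [cosTaylor, Finset.sum_range_succ']) (fun y hy => ?_) hx
    convert sinTaylor_alternating_of_cosTaylor_alternating (fun _ => ih) hy using 1
    ring

theorem sinTaylor_alternating (n : ℕ) {x : ℝ} (hx : 0 ≤ x) :
    0 ≤ (-1) ^ (n + 1) * (sin x - sinTaylor (n + 1) x) :=
  sinTaylor_alternating_of_cosTaylor_alternating (fun _ => cosTaylor_alternating n) hx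

@[fun_prop]
theorem continuous_sinTaylor (n : ℕ) : Continuous (sinTaylor n) :=
  continuous_iff_continuousAt.2 fun x => (hasDerivAt_sinTaylor n x).continuousAt

@[fun_prop]
theorem continuous_cosTaylor (n : ℕ) : Continuous (cosTaylor n) := by
  unfold cosTaylor
  fun_prop

theorem integral_sin_pow_two_mul (k : ℕ) :
    ∫ θ in 0..π, sin θ ^ (2 * k) = π * ((2 * k).factorial / (2 ^ k * k.factorial) ^ 2) := by
  rw [integral_sin_pow_even]
  congr 1
  induction k with
  | zero => simp
  | succ k ih =>
    have hfact : (k.factorial : ℝ) ≠ 0 := by positivity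
    rw [Finset.prod_range_succ, ih, show 2 * (k + 1) = 2 * k + 1 + 1 by ring]
    simp only [Nat.factorial_succ]
    push_cast
    field_simp
    ring

/-- The Bessel function `J₀`, through Poisson's integral. -/
noncomputable def besselJ0 (t : ℝ) : ℝ := π⁻¹ * ∫ θ in 0..π, cos (t * sin θ)

/-- The Bessel function `J₁`, through Poisson's integral for `-J₀'`. -/
noncomputable def besselJ1 (t : ℝ) : ℝ := π⁻¹ * ∫ θ in 0..π, sin θ * sin (t * sin θ)

theorem besselJ0_taylor_alternating (n : ℕ) {t : ℝ} (ht : 0 ≤ t) :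
    0 ≤ (-1) ^ (n + 1) * (besselJ0 t -
      ∑ k ∈ Finset.range (n + 1), (-1) ^ k * (t / 2) ^ (2 * k) / k.factorial ^ 2) := by
  have hsum : ∫ θ in 0..π, cosTaylor (n + 1) (t * sin θ) =
      π * ∑ k ∈ Finset.range (n + 1), (-1) ^ k * (t / 2) ^ (2 * k) / k.factorial ^ 2 := by
    unfold cosTaylor
    rw [intervalIntegral.integral_finsetSum
      fun k _ => Continuous.intervalIntegrable (by fun_prop) _ _, Finset.mul_sum]
    refine Finset.sum_congr rfl fun k _ => ?_
    simp only [mul_pow, mul_div_right_comm, ← mul_assoc, intervalIntegral.integral_const_mul,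
      integral_sin_pow_two_mul, div_pow]
    field_simp
    ring
  calc 0 ≤ π⁻¹ * ∫ θ in 0..π, (-1) ^ (n + 1) *
        (cos (t * sin θ) - cosTaylor (n + 1) (t * sin θ)) :=
      mul_nonneg (inv_nonneg.2 pi_nonneg) (intervalIntegral.integral_nonneg pi_nonneg
        fun θ hθ => cosTaylor_alternating n (mul_nonneg ht (sin_nonneg_of_mem_Icc hθ)))
    _ = _ := by
      rw [intervalIntegral.integral_const_mul, intervalIntegral.integral_sub
        (Continuous.intervalIntegrable (by fun_prop) _ _)
        (Continuous.intervalIntegrable (by fun_prop) _ _), hsum, besselJ0, mul_left_comm,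
        mul_sub, inv_mul_cancel_left₀ pi_ne_zero]

theorem besselJ1_taylor_alternating (n : ℕ) {t : ℝ} (ht : 0 ≤ t) :
    0 ≤ (-1) ^ (n + 1) * (besselJ1 t - ∑ k ∈ Finset.range (n + 1),
      (-1) ^ k * (t / 2) ^ (2 * k + 1) / (k.factorial * (k + 1).factorial)) := by
  have hsum : ∫ θ in 0..π, sin θ * sinTaylor (n + 1) (t * sin θ) =
      π * ∑ k ∈ Finset.range (n + 1),
        (-1) ^ k * (t / 2) ^ (2 * k + 1) / (k.factorial * (k + 1).factorial) := by
    simp only [sinTaylor, Finset.mul_sum]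
    rw [intervalIntegral.integral_finsetSum
      fun k _ => Continuous.intervalIntegrable (by fun_prop) _ _]
    refine Finset.sum_congr rfl fun k _ => ?_
    have hsin (θ : ℝ) : sin θ * ((-1) ^ k * ((t * sin θ) ^ (2 * k + 1) / (2 * k + 1).factorial)) =
        (-1) ^ k * t ^ (2 * k + 1) / (2 * k + 1).factorial * sin θ ^ (2 * (k + 1)) := by ring
    simp only [hsin, intervalIntegral.integral_const_mul, integral_sin_pow_two_mul]
    rw [show 2 * (k + 1) = 2 * k + 1 + 1 by ring, Nat.factorial_succ (2 * k + 1),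
      Nat.factorial_succ k, div_pow]
    push_cast
    field_simp
    ring
  calc 0 ≤ π⁻¹ * ∫ θ in 0..π, sin θ * ((-1) ^ (n + 1) *
        (sin (t * sin θ) - sinTaylor (n + 1) (t * sin θ))) :=
      mul_nonneg (inv_nonneg.2 pi_nonneg) (intervalIntegral.integral_nonneg pi_nonneg
        fun θ hθ => mul_nonneg (sin_nonneg_of_mem_Icc hθ)
          (sinTaylor_alternating n (mul_nonneg ht (sin_nonneg_of_mem_Icc hθ))))
    _ = _ := by
      simp only [mul_left_comm (sin _) ((-1 : ℝ) ^ (n + 1)), mul_sub (sin _)]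
      rw [intervalIntegral.integral_const_mul, intervalIntegral.integral_sub
        (Continuous.intervalIntegrable (by fun_prop) _ _)
        (Continuous.intervalIntegrable (by fun_prop) _ _), hsum, besselJ1, mul_left_comm,
        mul_sub, inv_mul_cancel_left₀ pi_ne_zero]

theorem continuous_besselJ0 : Continuous besselJ0 :=
  continuous_const.mul
    (intervalIntegral.continuous_parametric_intervalIntegral_of_continuous' (by fun_prop) _ _)

theorem hasDerivAt_besselJ0 (t : ℝ) : HasDerivAt besselJ0 (-besselJ1 t) t := by
  have hderiv := (intervalIntegral.hasDerivAt_integral_of_dominated_loc_of_deriv_le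
    (μ := volume) (a := 0) (b := π) (F := fun t θ => cos (t * sin θ))
    (F' := fun t θ => -sin (t * sin θ) * sin θ) (x₀ := t) (s := Set.univ) (bound := fun _ => 1)
    Filter.univ_mem
    (Filter.Eventually.of_forall fun x => Continuous.aestronglyMeasurable (by fun_prop))
    (Continuous.intervalIntegrable (by fun_prop) _ _)
    (Continuous.aestronglyMeasurable (by fun_prop))
    (Filter.Eventually.of_forall fun θ _ x _ => by
      rw [norm_mul, norm_neg]
      exact mul_le_one₀ (abs_sin_le_one _) (norm_nonneg _) (abs_sin_le_one _))
    (by simp)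
    (Filter.Eventually.of_forall fun θ _ x _ => by
      simpa using ((hasDerivAt_id x).mul_const (sin θ)).cos)).2.const_mul π⁻¹
  refine hderiv.congr_deriv ?_
  simp only [besselJ1, intervalIntegral.integral_neg, mul_neg, mul_comm]

theorem hasDerivAt_besselJ1 {t : ℝ} (ht : t ≠ 0) :
    HasDerivAt besselJ1 (besselJ0 t - besselJ1 t / t) t := by
  have hderiv := (intervalIntegral.hasDerivAt_integral_of_dominated_loc_of_deriv_le
    (μ := volume) (a := 0) (b := π) (F := fun t θ => sin θ * sin (t * sin θ))
    (F' := fun t θ => sin θ * (cos (t * sin θ) * sin θ)) (x₀ := t) (s := Set.univ)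
    (bound := fun _ => 1) Filter.univ_mem
    (Filter.Eventually.of_forall fun x => Continuous.aestronglyMeasurable (by fun_prop))
    (Continuous.intervalIntegrable (by fun_prop) _ _)
    (Continuous.aestronglyMeasurable (by fun_prop))
    (Filter.Eventually.of_forall fun θ _ x _ => by
      rw [norm_mul, norm_mul]
      exact mul_le_one₀ (abs_sin_le_one _) (by positivity)
        (mul_le_one₀ (abs_cos_le_one _) (norm_nonneg _) (abs_sin_le_one _)))
    (by simp)
    (Filter.Eventually.of_forall fun θ _ x _ => by
      simpa using ((hasDerivAt_id x).mul_const (sin θ)).sin.const_mul (sin θ))).2.const_mul π⁻¹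
  refine hderiv.congr_deriv ?_
  have hparts : ∫ θ in 0..π, cos θ * (cos (t * sin θ) * (t * cos θ)) =
      ∫ θ in 0..π, sin θ * sin (t * sin θ) := by
    simpa using intervalIntegral.integral_mul_deriv_eq_deriv_mul (a := 0) (b := π)
      (u := cos) (v := fun θ => sin (t * sin θ)) (u' := fun θ => -sin θ)
      (v' := fun θ => cos (t * sin θ) * (t * cos θ))
      (fun θ _ => hasDerivAt_cos θ) (fun θ _ => ((hasDerivAt_sin θ).const_mul t).sin)
      (Continuous.intervalIntegrable (by fun_prop) _ _)
      (Continuous.intervalIntegrable (by fun_prop) _ _)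
  have hsplit : ∫ θ in 0..π, cos θ * (cos (t * sin θ) * (t * cos θ)) =
      t * ((∫ θ in 0..π, cos (t * sin θ)) - ∫ θ in 0..π, sin θ * (cos (t * sin θ) * sin θ)) := by
    rw [← intervalIntegral.integral_sub (Continuous.intervalIntegrable (by fun_prop) _ _)
      (Continuous.intervalIntegrable (by fun_prop) _ _), ← intervalIntegral.integral_const_mul]
    congr 1 with θ
    linear_combination (t * cos (t * sin θ)) * sin_sq_add_cos_sq θ
  rw [besselJ0, besselJ1, ← hparts, hsplit, mul_left_comm, mul_div_cancel_left₀ _ ht]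
  ring

theorem abs_besselJ0_le_one (t : ℝ) : |besselJ0 t| ≤ 1 := by
  have hint : |∫ θ in 0..π, cos (t * sin θ)| ≤ π := by
    simpa [abs_of_pos pi_pos] using intervalIntegral.norm_integral_le_of_norm_le_const
      (a := 0) (b := π) (C := 1) (f := fun θ => cos (t * sin θ)) fun θ _ => abs_cos_le_one _
  rw [besselJ0, abs_mul, abs_of_pos (inv_pos.2 pi_pos)]
  calc π⁻¹ * _ ≤ π⁻¹ * π := by gcongr
    _ = 1 := inv_mul_cancel₀ pi_ne_zero

theorem one_sub_sq_div_four_le_besselJ0 {t : ℝ} (ht : 0 ≤ t) : 1 - t ^ 2 / 4 ≤ besselJ0 t := by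
  have htaylor := besselJ0_taylor_alternating 1 ht
  norm_num [Finset.sum_range_succ] at htaylor
  linarith

theorem abs_besselJ0_le_exp {t : ℝ} (ht : 0 ≤ t) (ht_two : t ≤ 2) :
    |besselJ0 t| ≤ exp (-t ^ 2 / 4) := by
  have htaylor := besselJ0_taylor_alternating 2 ht
  have hlower := one_sub_sq_div_four_le_besselJ0 ht
  norm_num [Finset.sum_range_succ, Nat.factorial] at htaylor
  have hx₀ : 0 ≤ t ^ 2 / 4 := by positivity
  have hx₁ : t ^ 2 / 4 ≤ 1 := by nlinarith
  have hexp := (abs_le.1 (exp_bound (x := -(t ^ 2 / 4)) (by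
    rwa [abs_neg, abs_of_nonneg hx₀]) (n := 4) (by norm_num))).1
  norm_num [Finset.sum_range_succ, Nat.factorial, abs_of_nonneg hx₀] at hexp
  rw [abs_of_nonneg (by linarith), neg_div]
  nlinarith [pow_nonneg hx₀ 2, pow_nonneg hx₀ 3, mul_nonneg (pow_nonneg hx₀ 2) (sub_nonneg.2 hx₁)]

theorem antitoneOn_besselJ0_sq_add_besselJ1_sq :
    AntitoneOn (fun t => besselJ0 t ^ 2 + besselJ1 t ^ 2) (Set.Ioi 0) := by
  have hderiv : ∀ t ∈ Set.Ioi (0 : ℝ), HasDerivAt (fun t => besselJ0 t ^ 2 + besselJ1 t ^ 2)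
      (-(2 * besselJ1 t ^ 2 / t)) t := by
    intro t (ht : 0 < t)
    refine (((hasDerivAt_besselJ0 t).pow 2).add
      ((hasDerivAt_besselJ1 ht.ne').pow 2)).congr_deriv ?_
    field_simp
    ring
  refine antitoneOn_of_hasDerivWithinAt_nonpos (convex_Ioi 0)
    (fun t ht => (hderiv t ht).continuousAt.continuousWithinAt)
    (fun t ht => (hderiv t (interior_subset ht)).hasDerivWithinAt) fun t ht => ?_
  have ht₀ : 0 < t := interior_subset ht
  exact neg_nonpos.2 (by positivity)

theorem abs_besselJ0_le_of_le_four {t : ℝ} (ht : 37 / 20 ≤ t) (ht_four : t ≤ 4) :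
    |besselJ0 t| ≤ 21 / 50 := by
  have ht₀ : 0 ≤ t := by linarith
  have hupper := besselJ0_taylor_alternating 4 ht₀
  have hlower := besselJ0_taylor_alternating 5 ht₀
  obtain ⟨y, hy⟩ : ∃ y, (t / 2) ^ 2 = 4 - y := ⟨4 - (t / 2) ^ 2, by ring⟩
  simp only [pow_mul, hy] at hupper hlower
  norm_num [Finset.sum_range_succ, Nat.factorial] at hupper hlower
  have hy₀ : 0 ≤ y := by nlinarith
  have hy₁ : 0 ≤ 63 / 20 - y := by nlinarith
  rw [abs_le]
  constructor
  · nlinarith [pow_nonneg hy₀ 3, pow_nonneg hy₀ 4, pow_nonneg hy₀ 5, sq_nonneg (y - 2 / 7)]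
  · have hyy := mul_nonneg hy₀ hy₁
    nlinarith [mul_nonneg hyy (sq_nonneg y), mul_nonneg hyy hy₀]

theorem besselJ0_sq_add_besselJ1_sq_four_le :
    besselJ0 4 ^ 2 + besselJ1 4 ^ 2 ≤ (21 / 50) ^ 2 := by
  have hJ₀_upper := besselJ0_taylor_alternating 6 (t := 4) (by norm_num)
  have hJ₀_lower := besselJ0_taylor_alternating 5 (t := 4) (by norm_num)
  have hJ₁_upper := besselJ1_taylor_alternating 4 (t := 4) (by norm_num)
  have hJ₁_lower := besselJ1_taylor_alternating 5 (t := 4) (by norm_num)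
  norm_num [Finset.sum_range_succ, Nat.factorial] at hJ₀_upper hJ₀_lower hJ₁_upper hJ₁_lower
  nlinarith

-- The threshold is chosen so that `21 / 50 ≤ exp (-t ^ 2 / 4)` for `t ≤ 37 / 20`.
theorem abs_besselJ0_le_of_ge {t : ℝ} (ht : 37 / 20 ≤ t) : |besselJ0 t| ≤ 21 / 50 := by
  rcases le_total t 4 with ht_four | ht_four
  · exact abs_besselJ0_le_of_le_four ht ht_four
  · have hanti := antitoneOn_besselJ0_sq_add_besselJ1_sq (Set.mem_Ioi.2 four_pos)
      (Set.mem_Ioi.2 (four_pos.trans_le ht_four)) ht_four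
    refine abs_le_of_sq_le_sq ?_ (by norm_num)
    calc besselJ0 t ^ 2 ≤ besselJ0 t ^ 2 + besselJ1 t ^ 2 := le_add_of_nonneg_right (sq_nonneg _)
      _ ≤ besselJ0 4 ^ 2 + besselJ1 4 ^ 2 := hanti
      _ ≤ (21 / 50) ^ 2 := besselJ0_sq_add_besselJ1_sq_four_le

/-! ### The kernel `(1 - cos t) / t ^ 2` -/

theorem integrableOn_div_sq {f : ℝ → ℝ} (hf : Measurable f) {C D : ℝ}
    (hf_sq : ∀ t, 0 < t → |f t| ≤ C * t ^ 2) (hf_bdd : ∀ t, 0 < t → |f t| ≤ D) :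
    IntegrableOn (fun t => f t / t ^ 2) (Set.Ioi 0) := by
  refine Integrable.mono' (integrable_inv_one_add_sq.const_mul (C + D)).integrableOn
    (Measurable.aestronglyMeasurable (by fun_prop)) ((ae_restrict_iff' measurableSet_Ioi).2
      (Filter.Eventually.of_forall fun t (ht : 0 < t) => ?_))
  rw [norm_div, norm_eq_abs, norm_of_nonneg (sq_nonneg t), ← div_eq_mul_inv,
    div_le_div_iff₀ (by positivity) (by positivity)]
  nlinarith [hf_sq t ht, mul_le_mul_of_nonneg_right (hf_bdd t ht) (sq_nonneg t)]

theorem integrableOn_one_sub_exp_div_sq {b : ℝ} (hb : 0 ≤ b) :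
    IntegrableOn (fun t : ℝ => (1 - exp (-b * t ^ 2)) / t ^ 2) (Set.Ioi 0) := by
  have habs (t : ℝ) : |1 - exp (-b * t ^ 2)| = 1 - exp (-b * t ^ 2) :=
    abs_of_nonneg (sub_nonneg.2 (exp_le_one_iff.2 (by nlinarith [sq_nonneg t])))
  refine integrableOn_div_sq (C := b) (D := 1) (by fun_prop) (fun t _ => ?_) fun t _ => ?_
  · linarith [habs t, add_one_le_exp (-b * t ^ 2)]
  · linarith [habs t, exp_pos (-b * t ^ 2)]

theorem integral_one_sub_exp_div_sq {b : ℝ} (hb : 0 < b) :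
    ∫ t in Set.Ioi (0 : ℝ), (1 - exp (-b * t ^ 2)) / t ^ 2 = √(π * b) := by
  have hdiv := integrableOn_one_sub_exp_div_sq hb.le
  have hexp : IntegrableOn (fun t : ℝ => exp (-b * t ^ 2)) (Set.Ioi 0) :=
    (integrable_exp_neg_mul_sq hb).integrableOn
  have hexp_le (t : ℝ) : exp (-b * t ^ 2) ≤ 1 := exp_le_one_iff.2 (by nlinarith [sq_nonneg t])
  have hderiv (t : ℝ) (ht : t ∈ Set.Ioi 0) : HasDerivAt (fun t : ℝ => -((1 - exp (-b * t ^ 2)) / t))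
      ((1 - exp (-b * t ^ 2)) / t ^ 2 - 2 * b * exp (-b * t ^ 2)) t := by
    have ht₀ : t ≠ 0 := ne_of_gt ht
    have hexp_deriv := ((hasDerivAt_pow 2 t).const_mul (-b)).exp
    refine ((hexp_deriv.const_sub 1).fun_div (hasDerivAt_id t) ht₀).fun_neg.congr_deriv ?_
    simp only [id]
    field_simp
    ring
  have hzero : ContinuousWithinAt (fun t : ℝ => -((1 - exp (-b * t ^ 2)) / t)) (Set.Ici 0) 0 := by
    refine ContinuousAt.continuousWithinAt ?_
    simp only [ContinuousAt, div_zero, neg_zero]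
    refine squeeze_zero_norm (a := fun t : ℝ => b * |t|) (fun t => ?_)
      (Continuous.tendsto' (by fun_prop) 0 0 (by simp))
    rcases eq_or_ne t 0 with rfl | ht
    · simp
    · rw [norm_neg, norm_div, norm_of_nonneg (sub_nonneg.2 (hexp_le t)), norm_eq_abs,
        div_le_iff₀ (abs_pos.2 ht), mul_assoc, abs_mul_abs_self]
      linarith [add_one_le_exp (-b * t ^ 2)]
  have htop :
      Filter.Tendsto (fun t : ℝ => -((1 - exp (-b * t ^ 2)) / t)) Filter.atTop (nhds 0) := by
    refine squeeze_zero_norm' ?_ tendsto_inv_atTop_zero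
    filter_upwards [Filter.eventually_gt_atTop 0] with t ht
    rw [norm_neg, norm_div, norm_of_nonneg (sub_nonneg.2 (hexp_le t)), norm_of_nonneg ht.le,
      inv_eq_one_div]
    gcongr
    linarith [exp_pos (-b * t ^ 2)]
  have hparts := integral_Ioi_of_hasDerivAt_of_tendsto hzero hderiv
    (hdiv.sub (hexp.const_mul _)) htop
  rw [integral_sub hdiv (hexp.const_mul _), integral_const_mul, integral_gaussian_Ioi,
    div_zero, neg_zero, sub_zero, sub_eq_zero] at hparts
  rw [hparts, show π * b = b ^ 2 * (π / b) by field_simp, sqrt_mul (by positivity), sqrt_sq hb.le]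
  ring

theorem integrableOn_one_sub_cos_mul_div_sq (x : ℝ) :
    IntegrableOn (fun t : ℝ => (1 - cos (t * x)) / t ^ 2) (Set.Ioi 0) := by
  have habs (y : ℝ) : |1 - cos y| = 1 - cos y := abs_of_nonneg (sub_nonneg.2 (cos_le_one y))
  refine integrableOn_div_sq (C := x ^ 2 / 2) (D := 2) (by fun_prop) (fun t _ => ?_) fun t _ => ?_
  · linarith [habs (t * x), one_sub_sq_div_two_le_cos (x := t * x), mul_pow t x 2]
  · linarith [habs (t * x), neg_one_le_cos (t * x)]

theorem integral_one_sub_cos_mul_div_sq (x : ℝ) :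
    ∫ t in Set.Ioi (0 : ℝ), (1 - cos (t * x)) / t ^ 2 =
      (∫ t in Set.Ioi (0 : ℝ), (1 - cos t) / t ^ 2) * |x| := by
  rcases eq_or_ne x 0 with rfl | hx
  · simp
  have hscale := integral_comp_mul_right_Ioi (fun t : ℝ => (1 - cos t) / t ^ 2) 0 (abs_pos.2 hx)
  rw [zero_mul, smul_eq_mul, eq_inv_mul_iff_mul_eq₀ (abs_ne_zero.2 hx)] at hscale
  rw [← hscale, mul_right_comm, ← sq, sq_abs, ← integral_const_mul]
  refine setIntegral_congr_fun measurableSet_Ioi fun t (ht : 0 < t) => ?_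
  have hcos : cos (t * |x|) = cos (t * x) := by
    rw [← abs_of_pos ht, ← abs_mul, cos_abs, abs_of_pos ht]
  simp only [hcos, mul_pow, sq_abs]
  field_simp

section CosineTransform

variable {X : Type*} [MeasurableSpace X] {μ : Measure X} {f : X → ℝ}

theorem integrable_prod_one_sub_cos_mul_div_sq (hf : Integrable f μ) :
    Integrable (fun p : X × ℝ => (1 - cos (p.2 * f p.1)) / p.2 ^ 2)
      (μ.prod (volume.restrict (Set.Ioi 0))) := by
  have hf_meas := hf.aestronglyMeasurable
  refine (integrable_prod_iff ?_).2 ⟨Filter.Eventually.of_forall fun x =>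
    integrableOn_one_sub_cos_mul_div_sq (f x), ?_⟩
  · have hcos : AEMeasurable (fun p : X × ℝ => cos (p.2 * f p.1))
        (μ.prod (volume.restrict (Set.Ioi 0))) :=
      measurable_cos.comp_aemeasurable
        (measurable_snd.aemeasurable.mul hf_meas.aemeasurable.comp_fst)
    exact ((hcos.const_sub 1).div (by fun_prop)).aestronglyMeasurable
  · have hnorm (x : X) : ∫ t in Set.Ioi (0 : ℝ), ‖(1 - cos (t * f x)) / t ^ 2‖ =
        (∫ t in Set.Ioi (0 : ℝ), (1 - cos t) / t ^ 2) * |f x| := by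
      rw [← integral_one_sub_cos_mul_div_sq]
      exact integral_congr_ae (Filter.Eventually.of_forall fun t =>
        norm_of_nonneg (div_nonneg (sub_nonneg.2 (cos_le_one _)) (sq_nonneg t)))
    simp only [hnorm]
    exact hf.abs.const_mul _

theorem integrableOn_integral_one_sub_cos_div_sq [SFinite μ] (hf : Integrable f μ) :
    IntegrableOn (fun t : ℝ => (∫ x, (1 - cos (t * f x)) ∂μ) / t ^ 2) (Set.Ioi 0) := by
  simpa only [integral_div, IntegrableOn] using
    (integrable_prod_one_sub_cos_mul_div_sq hf).integral_prod_right

theorem integral_integral_one_sub_cos_div_sq [SFinite μ] (hf : Integrable f μ) :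
    ∫ t in Set.Ioi (0 : ℝ), (∫ x, (1 - cos (t * f x)) ∂μ) / t ^ 2 =
      (∫ t in Set.Ioi (0 : ℝ), (1 - cos t) / t ^ 2) * ∫ x, |f x| ∂μ := by
  simp only [← integral_div]
  rw [← integral_integral_swap (integrable_prod_one_sub_cos_mul_div_sq hf)]
  simp only [integral_one_sub_cos_mul_div_sq, integral_const_mul]

end CosineTransform

theorem integral_cos_eq_re_integral_exp {X : Type*} [MeasurableSpace X] {μ : Measure X}
    [IsFiniteMeasure μ] {f : X → ℝ} (hf : AEMeasurable f μ) :
    ∫ x, cos (f x) ∂μ = (∫ x, Complex.exp (f x * Complex.I) ∂μ).re := by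
  have hint : Integrable (fun x => Complex.exp (f x * Complex.I)) μ :=
    Integrable.of_bound (by fun_prop) 1
      (Filter.Eventually.of_forall fun x => (Complex.norm_exp_ofReal_mul_I _).le)
  simpa only [RCLike.re_eq_complex_re, Complex.exp_ofReal_mul_I_re] using integral_re hint

theorem integral_abs_gaussianReal :
    ∫ x, |x| ∂ProbabilityTheory.gaussianReal 0 1 = √(2 / π) := by
  have hhalf : ∫ x in Set.Ioi (0 : ℝ), x * exp (-(1 / 2) * x ^ 2) = 1 := by
    have hgamma := integral_rpow_mul_exp_neg_mul_rpow (p := 2) (q := 1) (b := 1 / 2)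
      (by norm_num) (by norm_num) (by norm_num)
    norm_num at hgamma
    simpa using hgamma
  have hdensity (x : ℝ) : ProbabilityTheory.gaussianPDFReal 0 1 x • |x| =
      (√(2 * π))⁻¹ * (|x| * exp (-(1 / 2) * |x| ^ 2)) := by
    rw [ProbabilityTheory.gaussianPDFReal, sq_abs, smul_eq_mul, mul_assoc, mul_comm (exp _)]
    simp only [sub_zero, NNReal.coe_one, mul_one, div_eq_inv_mul, mul_neg, neg_mul]
  rw [ProbabilityTheory.integral_gaussianReal_eq_integral_smul one_ne_zero]
  simp only [hdensity]
  rw [integral_const_mul, integral_comp_abs (f := fun x => x * exp (-(1 / 2) * x ^ 2)), hhalf]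
  rw [mul_one, ← div_eq_inv_mul, sqrt_div zero_le_two, sqrt_mul zero_le_two]
  field_simp
  rw [sq_sqrt zero_le_two]

theorem integral_cos_mul_gaussianReal (t : ℝ) :
    ∫ x, cos (t * x) ∂ProbabilityTheory.gaussianReal 0 1 = exp (-(1 / 2) * t ^ 2) := by
  have hchar := charFun_apply_real (μ := ProbabilityTheory.gaussianReal 0 1) t
  rw [ProbabilityTheory.charFun_gaussianReal] at hchar
  have hre := integral_cos_eq_re_integral_exp (μ := ProbabilityTheory.gaussianReal 0 1)
    (f := fun x => t * x) (by fun_prop)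
  push_cast at hre
  rw [hre, ← hchar, ← Complex.exp_ofReal_re]
  push_cast
  ring_nf

-- A standard Gaussian variable identifies the constant in `integral_integral_one_sub_cos_div_sq`.
theorem integral_one_sub_cos_div_sq :
    ∫ t in Set.Ioi (0 : ℝ), (1 - cos t) / t ^ 2 = π / 2 := by
  have hid : Integrable id (ProbabilityTheory.gaussianReal 0 1) :=
    ProbabilityTheory.IsGaussian.integrable_id
  have hcos (t : ℝ) : ∫ x, (1 - cos (t * id x)) ∂ProbabilityTheory.gaussianReal 0 1 =
      1 - exp (-(1 / 2) * t ^ 2) := by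
    have hint : Integrable (fun x => cos (t * x)) (ProbabilityTheory.gaussianReal 0 1) :=
      Integrable.of_bound (by fun_prop) 1 (Filter.Eventually.of_forall fun x => abs_cos_le_one _)
    simp [integral_sub (integrable_const _) hint, integral_cos_mul_gaussianReal]
  have hgauss := integral_integral_one_sub_cos_div_sq hid
  simp only [hcos] at hgauss
  rw [integral_one_sub_exp_div_sq one_half_pos] at hgauss
  simp only [id, integral_abs_gaussianReal] at hgauss
  refine (eq_div_of_mul_eq (by positivity) hgauss.symm).trans ?_
  rw [← sqrt_div (by positivity), show π * (1 / 2) / (2 / π) = (π / 2) ^ 2 by field_simp,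
    sqrt_sq (by positivity)]

/-! ### Steinhaus sums -/

instance isProbabilityMeasure_unitAddCircle :
    IsProbabilityMeasure (volume : Measure UnitAddCircle) :=
  ⟨UnitAddCircle.measure_univ⟩

theorem integral_comp_toCircle {E : Type*} [NormedAddCommGroup E] [NormedSpace ℝ E] (f : ℂ → E) :
    ∫ τ : UnitAddCircle, f τ.toCircle = circleAverage f 0 1 := by
  have hscale (x : ℝ) :
      f (AddCircle.toCircle (x : UnitAddCircle)) = f (circleMap 0 1 (2 * π * x)) := by
    simp [AddCircle.toCircle_apply_mk, Circle.coe_exp, circleMap]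
  rw [← UnitAddCircle.intervalIntegral_preimage 0]
  simp only [hscale, zero_add]
  rw [intervalIntegral.integral_comp_mul_left (fun θ => f (circleMap 0 1 θ)) two_pi_pos.ne',
    mul_zero, mul_one, circleAverage]

theorem integral_comp_mul_toCircle {E : Type*} [NormedAddCommGroup E] [NormedSpace ℝ E]
    (f : Circle → E) (u : Circle) :
    ∫ τ : UnitAddCircle, f (u * τ.toCircle) = ∫ τ : UnitAddCircle, f τ.toCircle := by
  obtain ⟨σ, rfl⟩ := (AddCircle.homeomorphCircle (T := 1) one_ne_zero).surjective u
  simp only [AddCircle.homeomorphCircle_apply, ← AddCircle.toCircle_add]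
  exact integral_add_left_eq_self (fun τ : UnitAddCircle => f τ.toCircle) σ

theorem exists_eq_mul_circle_of_norm_eq {c d : ℂ} (hcd : ‖c‖ = ‖d‖) :
    ∃ u : Circle, c = d * u := by
  rcases eq_or_ne d 0 with rfl | hd
  · exact ⟨1, by simpa using hcd⟩
  · exact ⟨⟨c / d, by simp [Submonoid.unitSphere, hcd, norm_ne_zero_iff.2 hd]⟩,
      (mul_div_cancel₀ c hd).symm⟩

theorem integral_comp_const_mul_toCircle {E : Type*} [NormedAddCommGroup E] [NormedSpace ℝ E]
    (f : ℂ → E) {c d : ℂ} (hcd : ‖c‖ = ‖d‖) :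
    ∫ τ : UnitAddCircle, f (c * τ.toCircle) = ∫ τ : UnitAddCircle, f (d * τ.toCircle) := by
  obtain ⟨u, rfl⟩ := exists_eq_mul_circle_of_norm_eq hcd
  simpa only [mul_assoc, Circle.coe_mul] using
    integral_comp_mul_toCircle (fun v : Circle => f (d * v)) u

theorem integral_comp_re_mul_toCircle {E : Type*} [NormedAddCommGroup E] [NormedSpace ℝ E]
    {f : ℝ → E} (hf : Continuous f) (c : ℂ) :
    ∫ τ : UnitAddCircle, f (c * τ.toCircle).re =
      (2 * π)⁻¹ • ∫ θ in 0..π, (f (‖c‖ * sin θ) + f (-(‖c‖ * sin θ))) := by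
  have hsin (θ : ℝ) : (-Complex.I * ‖c‖ * circleMap 0 1 θ).re = ‖c‖ * sin θ := by
    simp [circleMap, Complex.exp_ofReal_mul_I_im]
  have hint (a b : ℝ) : IntervalIntegrable (fun θ => f (‖c‖ * sin θ)) volume a b :=
    Continuous.intervalIntegrable (by fun_prop) _ _
  have hshift : ∫ θ in π..2 * π, f (‖c‖ * sin θ) = ∫ θ in 0..π, f (-(‖c‖ * sin θ)) := by
    simpa [sin_add_pi, two_mul] using
      (intervalIntegral.integral_comp_add_right (a := 0) (b := π)
        (fun θ => f (‖c‖ * sin θ)) π).symm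
  rw [integral_comp_const_mul_toCircle (fun z => f z.re) (d := -Complex.I * ‖c‖) (by simp),
    integral_comp_toCircle fun z => f (-Complex.I * ‖c‖ * z).re, circleAverage]
  simp only [hsin]
  rw [← intervalIntegral.integral_add_adjacent_intervals (hint 0 π) (hint π _), hshift,
    intervalIntegral.integral_add (hint 0 π) (Continuous.intervalIntegrable (by fun_prop) _ _)]

theorem integral_exp_re_mul_toCircle (c : ℂ) :
    ∫ τ : UnitAddCircle, Complex.exp ((c * τ.toCircle).re * Complex.I) = besselJ0 ‖c‖ := by
  have hcos (x : ℝ) : Complex.exp (x * Complex.I) + Complex.exp ((-x : ℝ) * Complex.I) =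
      ((2 * cos x : ℝ) : ℂ) := by
    push_cast
    rw [Complex.cos, mul_div_cancel₀ _ two_ne_zero]
  rw [integral_comp_re_mul_toCircle (f := fun x => Complex.exp (x * Complex.I)) (by fun_prop)]
  simp only [hcos, intervalIntegral.integral_ofReal, intervalIntegral.integral_const_mul, besselJ0]
  rw [Complex.real_smul, ← Complex.ofReal_mul]
  congr 1
  field_simp

theorem integral_abs_re_mul_toCircle (c : ℂ) :
    ∫ τ : UnitAddCircle, |(c * τ.toCircle).re| = 2 / π * ‖c‖ := by
  rw [integral_comp_re_mul_toCircle (f := fun x => |x|) (by fun_prop)]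
  have habs : ∫ θ in 0..π, (|‖c‖ * sin θ| + |-(‖c‖ * sin θ)|) =
      ∫ θ in 0..π, 2 * ‖c‖ * sin θ := by
    refine intervalIntegral.integral_congr fun θ hθ => ?_
    rw [Set.uIcc_of_le pi_nonneg] at hθ
    simp only [abs_neg, abs_of_nonneg (mul_nonneg (norm_nonneg c) (sin_nonneg_of_mem_Icc hθ))]
    ring
  rw [habs, intervalIntegral.integral_const_mul, integral_sin, cos_zero, cos_pi, smul_eq_mul]
  field_simp
  ring

theorem integrable_of_continuous {X : Type*} [TopologicalSpace X] [CompactSpace X]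
    [MeasurableSpace X] [OpensMeasurableSpace X] {μ : Measure X} [IsFiniteMeasureOnCompacts μ]
    {f : X → ℝ} (hf : Continuous f) : Integrable f μ :=
  hf.integrable_of_hasCompactSupport (.of_compactSpace f)

section Steinhaus

variable {ι : Type*} [Fintype ι]

theorem integral_integral_comp_add {F : (ι → UnitAddCircle) → ℝ} (hF : Continuous F)
    {g : UnitAddCircle → ι → UnitAddCircle} (hg : Continuous g) :
    ∫ θ, ∫ σ, F (θ + g σ) = ∫ θ, F θ := by
  rw [integral_integral_swap (integrable_of_continuous (by fun_prop))]
  simp only [integral_add_right_eq_self F, integral_const, probReal_univ, one_smul]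

theorem integral_comp_sum_insert [DecidableEq ι] {f : ℂ → ℝ} (hf : Continuous f) (c : ι → ℂ)
    {i : ι} {s : Finset ι} (hi : i ∉ s) :
    ∫ θ : ι → UnitAddCircle, f (∑ k ∈ insert i s, c k * (θ k).toCircle) =
      ∫ θ : ι → UnitAddCircle, ∫ σ : UnitAddCircle,
        f (c i * σ.toCircle + ∑ k ∈ s, c k * (θ k).toCircle) := by
  have hsplit (θ : ι → UnitAddCircle) (σ : UnitAddCircle) :
      ∑ k ∈ insert i s, c k * (AddCircle.toCircle ((θ + Pi.single i σ : ι → UnitAddCircle) k) : ℂ) =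
        c i * (θ i).toCircle * σ.toCircle + ∑ k ∈ s, c k * (θ k).toCircle := by
    rw [Finset.sum_insert hi]
    congr 1
    · simp [AddCircle.toCircle_add, mul_assoc]
    · exact Finset.sum_congr rfl fun k hk => by simp [ne_of_mem_of_not_mem hk hi]
  rw [← integral_integral_comp_add (g := fun σ => Pi.single i σ) (by fun_prop)
    (continuous_single (A := fun _ => UnitAddCircle) i)]
  refine integral_congr_ae (.of_forall fun θ => ?_)
  simp only [hsplit]
  exact integral_comp_const_mul_toCircle
    (fun z => f (z + ∑ k ∈ s, c k * (θ k).toCircle))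
    (by rw [norm_mul, Circle.norm_coe, mul_one])

theorem integral_abs_re_sum (c : ι → ℂ) :
    ∫ θ : ι → UnitAddCircle, |(∑ k, c k * (θ k).toCircle).re| =
      2 / π * ∫ θ : ι → UnitAddCircle, ‖∑ k, c k * (θ k).toCircle‖ := by
  have hrotate (σ : UnitAddCircle) (θ : ι → UnitAddCircle) :
      ∑ k, c k * (AddCircle.toCircle ((θ + fun _ => σ : ι → UnitAddCircle) k) : ℂ) =
        (∑ k, c k * (θ k).toCircle) * σ.toCircle := by
    simp only [Pi.add_apply, AddCircle.toCircle_add, Circle.coe_mul, Finset.sum_mul]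
    exact Finset.sum_congr rfl fun k _ => by ring
  rw [← integral_integral_comp_add (g := fun σ _ => σ) (by fun_prop) (by fun_prop)]
  simp only [hrotate, integral_abs_re_mul_toCircle, integral_const_mul]

theorem integral_cos_re_sum (c : ι → ℂ) (t : ℝ) :
    ∫ θ : ι → UnitAddCircle, cos (t * (∑ k, c k * (θ k).toCircle).re) =
      ∏ k, besselJ0 (|t| * ‖c k‖) := by
  have hexp (θ : ι → UnitAddCircle) :
      Complex.exp ((t * (∑ k, c k * (θ k).toCircle).re : ℝ) * Complex.I) =
        ∏ k, Complex.exp ((t * c k * (θ k).toCircle).re * Complex.I) := by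
    rw [← Complex.exp_sum, Complex.re_sum, Finset.mul_sum, Complex.ofReal_sum, Finset.sum_mul]
    simp only [mul_assoc, Complex.re_ofReal_mul]
  rw [integral_cos_eq_re_integral_exp (Continuous.aemeasurable (by fun_prop))]
  simp only [hexp]
  rw [integral_fintype_prod_volume_eq_prod
    (fun k (τ : UnitAddCircle) => Complex.exp ((t * c k * τ.toCircle).re * Complex.I))]
  simp only [integral_exp_re_mul_toCircle, norm_mul, Complex.norm_real, norm_eq_abs,
    ← Complex.ofReal_prod, Complex.ofReal_re]

theorem integral_one_sub_cos_re_sum (c : ι → ℂ) {t : ℝ} (ht : 0 ≤ t) :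
    ∫ θ : ι → UnitAddCircle, (1 - cos (t * (∑ k, c k * (θ k).toCircle).re)) =
      1 - ∏ k, besselJ0 (t * ‖c k‖) := by
  rw [integral_sub (integrable_const _) (integrable_of_continuous (by fun_prop)),
    integral_cos_re_sum, abs_of_nonneg ht, integral_const, probReal_univ, one_smul]

theorem integrableOn_one_sub_prod_besselJ0_div_sq (c : ι → ℂ) :
    IntegrableOn (fun t : ℝ => (1 - ∏ k, besselJ0 (t * ‖c k‖)) / t ^ 2) (Set.Ioi 0) := by
  have hint : Integrable fun θ : ι → UnitAddCircle => (∑ k, c k * (θ k).toCircle).re :=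
    integrable_of_continuous (by fun_prop)
  exact (integrableOn_integral_one_sub_cos_div_sq hint).congr_fun
    (fun _ ht => by rw [← integral_one_sub_cos_re_sum c (Set.mem_Ioi.1 ht).le]) measurableSet_Ioi

theorem integral_norm_sum_eq_integral_besselJ0 (c : ι → ℂ) :
    ∫ θ : ι → UnitAddCircle, ‖∑ k, c k * (θ k).toCircle‖ =
      ∫ t in Set.Ioi (0 : ℝ), (1 - ∏ k, besselJ0 (t * ‖c k‖)) / t ^ 2 := by
  have hint : Integrable fun θ : ι → UnitAddCircle => (∑ k, c k * (θ k).toCircle).re :=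
    integrable_of_continuous (by fun_prop)
  have hcos := integral_integral_one_sub_cos_div_sq hint
  rw [integral_abs_re_sum, integral_one_sub_cos_div_sq, ← mul_assoc,
    div_mul_div_cancel₀ two_ne_zero, div_self pi_ne_zero, one_mul] at hcos
  rw [← hcos]
  exact setIntegral_congr_fun measurableSet_Ioi fun t ht => by
    rw [← integral_one_sub_cos_re_sum c (Set.mem_Ioi.1 ht).le]

end Steinhaus

theorem integral_norm_one_add_toCircle :
    ∫ τ : UnitAddCircle, ‖1 + (τ.toCircle : ℂ)‖ = 4 / π := by
  have hdouble (τ : UnitAddCircle) :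
      ‖1 + (AddCircle.toCircle (2 • τ) : ℂ)‖ = 2 * |((1 : ℂ) * τ.toCircle).re| := by
    have hfactor : 1 + (AddCircle.toCircle (2 • τ) : ℂ) =
        τ.toCircle * (τ.toCircle + (starRingEnd ℂ) τ.toCircle) := by
      rw [mul_add, Complex.mul_conj, Circle.normSq_coe, AddCircle.toCircle_nsmul, Circle.coe_pow]
      push_cast
      ring
    rw [hfactor, norm_mul, Circle.norm_coe, Complex.add_conj, Complex.norm_real, norm_eq_abs,
      abs_mul, abs_two, one_mul, one_mul]
  rw [← (AddCircle.ergodic_nsmul (T := 1) one_lt_two).map_eq, integral_map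
    (by fun_prop) (Continuous.aestronglyMeasurable (by fun_prop))]
  simp only [hdouble, integral_const_mul, integral_abs_re_mul_toCircle, norm_one]
  ring

theorem integral_one_sub_besselJ0_sq_div_sq :
    ∫ t in Set.Ioi (0 : ℝ), (1 - besselJ0 t ^ 2) / t ^ 2 = 4 / π := by
  have hrotate (w : Circle) :
      ∫ σ : UnitAddCircle, ‖(1 : ℂ) * σ.toCircle + w‖ = 4 / π := by
    have hfactor (σ : UnitAddCircle) : ‖(w : ℂ) * σ.toCircle + w‖ = ‖1 + (σ.toCircle : ℂ)‖ := by
      rw [← mul_add_one, norm_mul, Circle.norm_coe, one_mul, add_comm]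
    rw [integral_comp_const_mul_toCircle (fun z => ‖z + w‖) (d := w)
      (by rw [norm_one, Circle.norm_coe])]
    simp only [hfactor, integral_norm_one_add_toCircle]
  have hsum := integral_norm_sum_eq_integral_besselJ0 fun _ : Fin 2 => (1 : ℂ)
  rw [show (Finset.univ : Finset (Fin 2)) = insert 0 {1} from rfl,
    integral_comp_sum_insert continuous_norm _ (by decide)] at hsum
  simp only [Finset.sum_singleton, one_mul] at hsum hrotate
  simp only [hrotate, integral_const, probReal_univ, one_smul, norm_one, mul_one,
    Finset.prod_const] at hsum
  exact hsum.symm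

/-! ### Khinchin's inequality: small coefficients -/

theorem integrableOn_one_sub_abs_besselJ0_rpow_div_sq {p : ℝ} (hp : 1 ≤ p) :
    IntegrableOn (fun t => (1 - |besselJ0 t| ^ p) / t ^ 2) (Set.Ioi 0) := by
  have habs (t : ℝ) : |1 - |besselJ0 t| ^ p| = 1 - |besselJ0 t| ^ p :=
    abs_of_nonneg (sub_nonneg.2 (rpow_le_one (abs_nonneg _) (abs_besselJ0_le_one t)
      (by linarith)))
  have hJ := continuous_besselJ0.measurable
  refine integrableOn_div_sq (C := p / 4) (D := 1) (by fun_prop) (fun t ht => ?_) fun t _ => ?_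
  · have hbernoulli := one_add_mul_self_le_rpow_one_add (s := |besselJ0 t| - 1)
      (by linarith [abs_nonneg (besselJ0 t)]) hp
    rw [add_sub_cancel] at hbernoulli
    rw [habs]
    nlinarith [one_sub_sq_div_four_le_besselJ0 ht.le, le_abs_self (besselJ0 t)]
  · rw [habs]
    linarith [rpow_nonneg (abs_nonneg (besselJ0 t)) p]

theorem rpow_sub_two_mul_sq {x p : ℝ} (hx : 0 ≤ x) (hp : 2 ≤ p) : x ^ (p - 2) * x ^ 2 = x ^ p := by
  rw [← rpow_natCast, ← rpow_add_of_nonneg hx (by linarith) (by norm_num)]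
  norm_num

theorem rpow_sub_two_mul_sq_sub_sq_le {m x y p : ℝ} (hm : 0 ≤ m) (hmx : m ≤ x) (hy : 0 ≤ y)
    (hyx : y ≤ x) (hp : 2 ≤ p) : m ^ (p - 2) * (x ^ 2 - y ^ 2) ≤ x ^ p - y ^ p := by
  have hsq : y ^ 2 ≤ x ^ 2 := by gcongr
  calc m ^ (p - 2) * (x ^ 2 - y ^ 2) ≤ x ^ (p - 2) * (x ^ 2 - y ^ 2) := by
        gcongr
    _ = x ^ p - x ^ (p - 2) * y ^ 2 := by rw [mul_sub, rpow_sub_two_mul_sq (hm.trans hmx) hp]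
    _ ≤ x ^ p - y ^ (p - 2) * y ^ 2 := by
        gcongr
    _ = x ^ p - y ^ p := by rw [rpow_sub_two_mul_sq hy hp]

theorem le_exp_neg_sq_div_four {u : ℝ} (hu : 0 ≤ u) (hu_le : u ≤ 37 / 20) :
    21 / 50 ≤ exp (-u ^ 2 / 4) := by
  have hexp_one : 0.3678 ≤ exp (-1) := by
    rw [exp_neg, le_inv_comm₀ (by norm_num) (exp_pos 1)]
    exact exp_one_lt_d9.le.trans (by norm_num)
  calc (21 / 50 : ℝ) ≤ 0.3678 * (0.144375 + 1) := by norm_num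
    _ ≤ exp (-1) * exp 0.144375 := by
        gcongr
        exact add_one_le_exp _
    _ = exp (-(37 / 20) ^ 2 / 4) := by
        rw [← exp_add]
        norm_num
    _ ≤ exp (-u ^ 2 / 4) := by gcongr

/-- An upper bound for the integral of `exp (-t ^ 2 / 2) / t ^ 2` over `(u, ∞)`: the boundary term
`exp (-u ^ 2 / 2) / u ^ 3` of an integration by parts, sharpened by `u ^ 2 + 2` in place of
`u ^ 2`. -/
noncomputable def gaussianTailBound (u : ℝ) : ℝ := exp (-(1 / 2) * u ^ 2) / (u * (u ^ 2 + 2))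

theorem hasDerivAt_neg_gaussianTailBound {u : ℝ} (hu : u ≠ 0) :
    HasDerivAt (fun t => -gaussianTailBound t)
      (exp (-(1 / 2) * u ^ 2) / u ^ 2 * ((u ^ 4 + 5 * u ^ 2 + 2) / (u ^ 2 + 2) ^ 2)) u := by
  have hexp : HasDerivAt (fun t : ℝ => exp (-(1 / 2) * t ^ 2))
      (exp (-(1 / 2) * u ^ 2) * (-(1 / 2) * (2 * u))) u := by
    simpa only [Nat.cast_ofNat, Nat.add_one_sub_one, pow_one] using
      ((hasDerivAt_pow 2 u).const_mul (-(1 / 2))).exp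
  have hdenom : HasDerivAt (fun t : ℝ => t * (t ^ 2 + 2)) (1 * (u ^ 2 + 2) + u * (2 * u)) u := by
    simpa only [Nat.cast_ofNat, Nat.add_one_sub_one, pow_one] using
      (hasDerivAt_id' u).fun_mul ((hasDerivAt_pow 2 u).add_const 2)
  have hpos : u ^ 2 + 2 ≠ 0 := by positivity
  refine (hexp.div hdenom (mul_ne_zero hu hpos)).neg.congr_deriv ?_
  field_simp
  ring

theorem tendsto_neg_gaussianTailBound :
    Filter.Tendsto (fun t => -gaussianTailBound t) Filter.atTop (nhds 0) := by
  refine squeeze_zero_norm' ?_ tendsto_inv_atTop_zero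
  filter_upwards [Filter.eventually_ge_atTop 1] with t ht
  have : 0 < t := by linarith
  rw [norm_neg, gaussianTailBound, norm_of_nonneg (by positivity), inv_eq_one_div]
  gcongr
  · exact exp_le_one_iff.2 (by nlinarith)
  · nlinarith

theorem integrableOn_and_integral_exp_div_sq_le {T : ℝ} (hT : 2 ≤ T ^ 2) (hT₀ : 0 < T) :
    IntegrableOn (fun u : ℝ => exp (-(1 / 2) * u ^ 2) / u ^ 2) (Set.Ioi T) ∧
    ∫ u in Set.Ioi T, exp (-(1 / 2) * u ^ 2) / u ^ 2 ≤ gaussianTailBound T := by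
  have hderiv (u : ℝ) (hu : u ∈ Set.Ici T) := hasDerivAt_neg_gaussianTailBound (hT₀.trans_le hu).ne'
  have hle (u : ℝ) (hu : u ∈ Set.Ioi T) : exp (-(1 / 2) * u ^ 2) / u ^ 2 ≤
      exp (-(1 / 2) * u ^ 2) / u ^ 2 * ((u ^ 4 + 5 * u ^ 2 + 2) / (u ^ 2 + 2) ^ 2) := by
    have hTu : T < u := hu
    refine le_mul_of_one_le_right (by positivity) ((one_le_div (by positivity)).2 ?_)
    nlinarith
  have hint := integrableOn_Ioi_deriv_of_nonneg' hderiv (fun u _ => by positivity)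
    tendsto_neg_gaussianTailBound
  have hint' : IntegrableOn (fun u : ℝ => exp (-(1 / 2) * u ^ 2) / u ^ 2) (Set.Ioi T) := by
    refine Integrable.mono' hint (Measurable.aestronglyMeasurable (by fun_prop))
      ((ae_restrict_iff' measurableSet_Ioi).2 (.of_forall fun u hu => ?_))
    rw [norm_of_nonneg (by positivity)]
    exact hle u hu
  refine ⟨hint', (setIntegral_mono_on hint' hint measurableSet_Ioi hle).trans_eq ?_⟩
  rw [integral_Ioi_of_hasDerivAt_of_nonneg' hderiv (fun u _ => by positivity)
    tendsto_neg_gaussianTailBound, zero_sub, neg_neg]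

theorem gaussianTailBound_le : gaussianTailBound (37 / 20) ≤ 0.0198 := by
  have hexp := sum_le_exp_of_nonneg (x := 1 / 2 * (37 / 20) ^ 2) (by norm_num) 5
  norm_num [Finset.sum_range_succ, Nat.factorial] at hexp
  rw [gaussianTailBound, neg_mul, exp_neg, div_le_iff₀ (by norm_num),
    inv_le_comm₀ (exp_pos _) (by norm_num)]
  norm_num
  linarith

theorem le_four_div_pi_sub_sqrt : 0.0198 ≤ 4 / π - √(π * (1 / 2)) := by
  have hsqrt : √(π * (1 / 2)) ≤ 1.25332 :=
    (sqrt_le_left (by norm_num)).2 (by linarith [pi_lt_d6])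
  have hdiv : 1.27323 ≤ 4 / π := (le_div_iff₀ pi_pos).2 (by linarith [pi_lt_d6])
  linarith

-- The difference of the `p`-th powers of `exp (-u ^ 2 / 4)` and `|J₀ u|` is compared with that of
-- the squares, because for `p = 2` both integrals are known exactly.
theorem one_sub_exp_add_le_one_sub_abs_besselJ0_rpow {u p : ℝ} (hu : 0 < u) (hp : 2 ≤ p) :
    1 - exp (-(p / 4) * u ^ 2) + (21 / 50) ^ (p - 2) *
      (1 - besselJ0 u ^ 2 - (1 - exp (-(1 / 2) * u ^ 2)) -
        (Set.Ioi (37 / 20)).indicator (fun t => exp (-(1 / 2) * t ^ 2)) u) ≤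
      1 - |besselJ0 u| ^ p := by
  have hexp_rpow : exp (-(p / 4) * u ^ 2) = exp (-u ^ 2 / 4) ^ p := by
    rw [← exp_mul]
    ring_nf
  have hexp_sq : exp (-(1 / 2) * u ^ 2) = exp (-u ^ 2 / 4) ^ 2 := by
    rw [← exp_nat_mul]
    ring_nf
  rw [Set.indicator_apply, ← sq_abs (besselJ0 u), hexp_rpow, hexp_sq]
  split_ifs with hmem
  · have hJ := abs_besselJ0_le_of_ge (Set.mem_Ioi.1 hmem).le
    have hmono : |besselJ0 u| ^ (p - 2) * |besselJ0 u| ^ 2 ≤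
        (21 / 50) ^ (p - 2) * |besselJ0 u| ^ 2 := by gcongr
    rw [rpow_sub_two_mul_sq (abs_nonneg _) hp] at hmono
    linarith [rpow_nonneg (exp_pos (-u ^ 2 / 4)).le p]
  · have hle := Set.notMem_Ioi.1 hmem
    linarith [rpow_sub_two_mul_sq_sub_sq_le (by norm_num) (le_exp_neg_sq_div_four hu.le hle)
      (abs_nonneg _) (abs_besselJ0_le_exp hu.le (by linarith)) hp]

theorem sqrt_le_integral_one_sub_abs_besselJ0_rpow {p : ℝ} (hp : 2 ≤ p) :
    √(π * (p / 4)) ≤ ∫ u in Set.Ioi (0 : ℝ), (1 - |besselJ0 u| ^ p) / u ^ 2 := by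
  set tail : ℝ → ℝ := (Set.Ioi (37 / 20)).indicator fun u => exp (-(1 / 2) * u ^ 2) / u ^ 2
    with htail
  have hgauss_p := integrableOn_one_sub_exp_div_sq (b := p / 4) (by linarith)
  have hgauss_two := integrableOn_one_sub_exp_div_sq (b := 1 / 2) (by norm_num)
  have hbessel_p := integrableOn_one_sub_abs_besselJ0_rpow_div_sq (p := p) (by linarith)
  have hbessel_two : IntegrableOn (fun u => (1 - besselJ0 u ^ 2) / u ^ 2) (Set.Ioi 0) := by
    simpa using integrableOn_one_sub_abs_besselJ0_rpow_div_sq one_le_two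
  obtain ⟨htail_int, htail_le⟩ :=
    integrableOn_and_integral_exp_div_sq_le (T := 37 / 20) (by norm_num) (by norm_num)
  have htail_intOn : IntegrableOn tail (Set.Ioi 0) :=
    ((integrable_indicator_iff measurableSet_Ioi).2 htail_int).integrableOn
  have htail_integral : ∫ u in Set.Ioi (0 : ℝ), tail u ≤ 0.0198 := by
    rw [setIntegral_indicator measurableSet_Ioi, Set.Ioi_inter_Ioi, sup_of_le_right (by norm_num)]
    exact htail_le.trans gaussianTailBound_le
  have hdiff := (hbessel_two.sub hgauss_two).sub htail_intOn
  have hmono := setIntegral_mono_on (hgauss_p.add (hdiff.const_mul ((21 / 50) ^ (p - 2))))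
    hbessel_p measurableSet_Ioi fun u hu => ?_
  · rw [integral_add' hgauss_p (hdiff.const_mul _), integral_const_mul,
      integral_sub' (hbessel_two.sub hgauss_two) htail_intOn,
      integral_sub' hbessel_two hgauss_two, integral_one_sub_besselJ0_sq_div_sq,
      integral_one_sub_exp_div_sq (by linarith), integral_one_sub_exp_div_sq (by norm_num)] at hmono
    have hgain : 0 ≤ 4 / π - √(π * (1 / 2)) - ∫ u in Set.Ioi (0 : ℝ), tail u := by
      linarith [le_four_div_pi_sub_sqrt]
    exact (le_add_of_nonneg_right (by positivity)).trans hmono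
  · have htail_apply : tail u =
        (Set.Ioi (37 / 20)).indicator (fun t => exp (-(1 / 2) * t ^ 2)) u / u ^ 2 := by
      simp only [htail, Set.indicator_apply]
      split_ifs <;> simp
    simp only [Pi.add_apply, Pi.sub_apply, htail_apply, ← sub_div, ← mul_div_assoc, ← add_div]
    gcongr
    exact one_sub_exp_add_le_one_sub_abs_besselJ0_rpow hu hp

theorem le_integral_one_sub_abs_besselJ0_scaled {a : ℝ} (ha : 0 < a) (ha_small : a ^ 2 ≤ 1 / 2) :
    IntegrableOn (fun t => (1 - |besselJ0 (t * a)| ^ (a ^ 2)⁻¹) / t ^ 2) (Set.Ioi 0) ∧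
      √π / 2 ≤ ∫ t in Set.Ioi (0 : ℝ), (1 - |besselJ0 (t * a)| ^ (a ^ 2)⁻¹) / t ^ 2 := by
  have hp : 2 ≤ (a ^ 2)⁻¹ := (le_inv_comm₀ two_pos (by positivity)).2 (by linarith)
  set f : ℝ → ℝ := fun u => (1 - |besselJ0 u| ^ (a ^ 2)⁻¹) / u ^ 2
  have hscale (t : ℝ) : (1 - |besselJ0 (t * a)| ^ (a ^ 2)⁻¹) / t ^ 2 = a ^ 2 * f (t * a) := by
    simp only [f, mul_pow]
    field_simp
  simp only [hscale]
  constructor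
  · have hcomp := (integrableOn_Ioi_comp_mul_right_iff f 0 ha).2
    rw [zero_mul] at hcomp
    exact (hcomp (integrableOn_one_sub_abs_besselJ0_rpow_div_sq (by linarith))).const_mul _
  · rw [integral_const_mul, integral_comp_mul_right_Ioi f 0 ha, zero_mul, smul_eq_mul]
    calc √π / 2 = a ^ 2 * (a⁻¹ * √(π * ((a ^ 2)⁻¹ / 4))) := by
          rw [show π * ((a ^ 2)⁻¹ / 4) = π / (2 * a) ^ 2 by ring, sqrt_div pi_nonneg,
            sqrt_sq (by positivity)]
          field_simp
      _ ≤ a ^ 2 * (a⁻¹ * ∫ u in Set.Ioi 0, f u) := by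
          gcongr
          exact sqrt_le_integral_one_sub_abs_besselJ0_rpow hp

section SmallCoefficients

variable {ι : Type*} [Fintype ι]

theorem abs_prod_besselJ0_le (t : ℝ) {a : ι → ℝ} (hsum : ∑ k, a k ^ 2 = 1) :
    |∏ k, besselJ0 (t * a k)| ≤ ∑ k, a k ^ 2 * |besselJ0 (t * a k)| ^ (a k ^ 2)⁻¹ := by
  have hroot (k : ι) : |besselJ0 (t * a k)| =
      (|besselJ0 (t * a k)| ^ (a k ^ 2)⁻¹) ^ (a k ^ 2) := by
    rcases eq_or_ne (a k) 0 with hk | hk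
    · simp [hk, besselJ0]
    · exact (rpow_inv_rpow (abs_nonneg _) (pow_ne_zero 2 hk)).symm
  calc |∏ k, besselJ0 (t * a k)|
      = ∏ k, (|besselJ0 (t * a k)| ^ (a k ^ 2)⁻¹) ^ (a k ^ 2) := by
        rw [Finset.abs_prod]
        exact Finset.prod_congr rfl fun k _ => hroot k
    _ ≤ _ := geom_mean_le_arith_mean_weighted _ _ _ (fun k _ => by positivity) hsum
        fun k _ => by positivity

theorem sqrt_pi_div_two_le_of_small {c : ι → ℂ} (hsum : ∑ k, ‖c k‖ ^ 2 = 1)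
    (hsmall : ∀ k, ‖c k‖ ^ 2 ≤ 1 / 2) :
    √π / 2 ≤ ∫ θ : ι → UnitAddCircle, ‖∑ k, c k * (θ k).toCircle‖ := by
  set F : ι → ℝ → ℝ := fun k t => (1 - |besselJ0 (t * ‖c k‖)| ^ (‖c k‖ ^ 2)⁻¹) / t ^ 2
  have hint (k : ι) : IntegrableOn (fun t => ‖c k‖ ^ 2 * F k t) (Set.Ioi 0) := by
    rcases (norm_nonneg (c k)).eq_or_lt with hk | hk
    · simp [← hk]
    · exact (le_integral_one_sub_abs_besselJ0_scaled hk (hsmall k)).1.const_mul _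
  have hle (k : ι) : ‖c k‖ ^ 2 * (√π / 2) ≤ ∫ t in Set.Ioi (0 : ℝ), ‖c k‖ ^ 2 * F k t := by
    rcases (norm_nonneg (c k)).eq_or_lt with hk | hk
    · simp [← hk]
    · rw [integral_const_mul]
      exact mul_le_mul_of_nonneg_left
        (le_integral_one_sub_abs_besselJ0_scaled hk (hsmall k)).2 (by positivity)
  rw [integral_norm_sum_eq_integral_besselJ0]
  calc √π / 2 = ∑ k, ‖c k‖ ^ 2 * (√π / 2) := by rw [← Finset.sum_mul, hsum, one_mul]
    _ ≤ ∑ k, ∫ t in Set.Ioi (0 : ℝ), ‖c k‖ ^ 2 * F k t := Finset.sum_le_sum fun k _ => hle k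
    _ = ∫ t in Set.Ioi (0 : ℝ), ∑ k, ‖c k‖ ^ 2 * F k t :=
        (integral_finsetSum _ fun k _ => hint k).symm
    _ ≤ _ := setIntegral_mono_on (integrable_finsetSum _ fun k _ => hint k)
        (integrableOn_one_sub_prod_besselJ0_div_sq c) measurableSet_Ioi fun t _ => by
          simp only [F, ← mul_div_assoc, ← Finset.sum_div, mul_sub, mul_one,
            Finset.sum_sub_distrib, hsum]
          gcongr
          exact (le_abs_self _).trans (abs_prod_besselJ0_le t hsum)

end SmallCoefficients

/-! ### Khinchin's inequality: one large coefficient -/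

theorem integral_toCircle_eq_of_differentiableOn {f : ℂ → ℂ}
    (hf : DifferentiableOn ℂ f (Metric.closedBall 0 1)) :
    ∫ τ : UnitAddCircle, f τ.toCircle = f 0 := by
  rw [integral_comp_toCircle]
  exact (DifferentiableOn.diffContOnCl_ball hf (by rw [abs_one])).circleAverage

theorem continuous_comp_toCircle {f : ℂ → ℂ} (hf : ContinuousOn f (Metric.closedBall 0 1)) :
    Continuous fun τ : UnitAddCircle => f τ.toCircle :=
  hf.comp_continuous (by fun_prop) fun τ => by
    rw [mem_closedBall_zero_iff, Circle.norm_coe]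

theorem integral_re_toCircle_of_differentiableOn {f : ℂ → ℂ}
    (hf : DifferentiableOn ℂ f (Metric.closedBall 0 1)) :
    ∫ τ : UnitAddCircle, (f τ.toCircle).re = (f 0).re := by
  rw [← integral_toCircle_eq_of_differentiableOn hf]
  exact integral_re (𝕜 := ℂ) <|
    (continuous_comp_toCircle hf.continuousOn).integrable_of_hasCompactSupport (.of_compactSpace _)

/-- The second Taylor polynomial of `√(1 + w)` at `0`; it is the test function which makes
`le_integral_norm_one_add` accurate. -/
noncomputable def sqrtTaylor (w : ℂ) : ℂ := 1 + w / 2 - w ^ 2 / 8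

theorem sqrtTaylor_ne_zero {w : ℂ} (hw : ‖w‖ ≤ 1) : sqrtTaylor w ≠ 0 := by
  intro hzero
  have hone : (1 : ℂ) = w ^ 2 / 8 - w / 2 := by
    rw [sqrtTaylor] at hzero
    linear_combination hzero
  have hnorm : (1 : ℝ) ≤ ‖w‖ ^ 2 / 8 + ‖w‖ / 2 := by
    have htri := norm_sub_le (w ^ 2 / 8) (w / 2)
    rw [← hone, norm_one, norm_div, norm_div, norm_pow] at htri
    norm_num at htri
    exact htri
  nlinarith [norm_nonneg w]

theorem one_add_eq_sqrtTaylor_sq_add (w : ℂ) :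
    1 + w = sqrtTaylor w ^ 2 + w ^ 3 * (1 / 8 - w / 64) := by
  rw [sqrtTaylor]
  ring

theorem conj_sqrtTaylor (w : ℂ) :
    (starRingEnd ℂ) (sqrtTaylor w) = sqrtTaylor ((starRingEnd ℂ) w) := by
  simp only [sqrtTaylor, map_sub, map_add, map_div₀, map_pow, map_one, map_ofNat]

theorem sq_mul_conj_sqrtTaylor (w : ℂ) : w ^ 2 * (starRingEnd ℂ) (sqrtTaylor w) =
    w ^ 2 + (‖w‖ : ℂ) ^ 2 * w / 2 - (‖w‖ : ℂ) ^ 4 / 8 := by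
  have hmul : w * (starRingEnd ℂ) w = (‖w‖ : ℂ) ^ 2 := Complex.mul_conj' w
  rw [conj_sqrtTaylor, sqrtTaylor]
  linear_combination (w / 2 - (w * (starRingEnd ℂ) w + (‖w‖ : ℂ) ^ 2) / 8) * hmul

theorem norm_sqrtTaylor_sq (w : ℂ) : ‖sqrtTaylor w‖ ^ 2 =
    1 + ‖w‖ ^ 2 / 4 + ‖w‖ ^ 4 / 64 + (w - w ^ 2 / 4 - (‖w‖ : ℂ) ^ 2 * w / 8).re := by
  have hmul : w * (starRingEnd ℂ) w = (‖w‖ : ℂ) ^ 2 := Complex.mul_conj' w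
  rw [← Complex.ofReal_inj, Complex.ofReal_pow, ← Complex.mul_conj', conj_sqrtTaylor,
    Complex.ofReal_add, Complex.re_eq_add_conj]
  simp only [sqrtTaylor, map_sub, map_div₀, map_mul, map_pow, map_ofNat, Complex.conj_ofReal]
  push_cast
  linear_combination (1 / 4 - (w + (starRingEnd ℂ) w) / 16 +
    (w * (starRingEnd ℂ) w + (‖w‖ : ℂ) ^ 2) / 64) * hmul

-- `‖1 + w‖ ≥ Re ((1 + w) conj q / q)` with `q = sqrtTaylor w`, whose phase is nearly that of
-- `√(1 + w)`.
theorem le_norm_one_add {w : ℂ} (hw : ‖w‖ ≤ 1) :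
    1 + ‖w‖ ^ 2 / 4 + ‖w‖ ^ 4 / 64 + (w - w ^ 2 / 4 - (‖w‖ : ℂ) ^ 2 * w / 8 +
      w * (1 / 8 - w / 64) * (w ^ 2 + (‖w‖ : ℂ) ^ 2 * w / 2 - (‖w‖ : ℂ) ^ 4 / 8) /
        sqrtTaylor w).re ≤ ‖1 + w‖ := by
  have hq := sqrtTaylor_ne_zero hw
  rw [Complex.add_re, ← add_assoc, ← norm_sqrtTaylor_sq, ← sq_mul_conj_sqrtTaylor]
  have hphase : ‖1 + w‖ = ‖(1 + w) * (starRingEnd ℂ) (sqrtTaylor w) / sqrtTaylor w‖ := by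
    rw [norm_div, norm_mul, RCLike.norm_conj, mul_div_cancel_right₀ _ (norm_ne_zero_iff.2 hq)]
  have hsplit : (1 + w) * (starRingEnd ℂ) (sqrtTaylor w) / sqrtTaylor w =
      ((‖sqrtTaylor w‖ ^ 2 : ℝ) : ℂ) + w * (1 / 8 - w / 64) *
        (w ^ 2 * (starRingEnd ℂ) (sqrtTaylor w)) / sqrtTaylor w := by
    rw [Complex.ofReal_pow, ← Complex.mul_conj', one_add_eq_sqrtTaylor_sq_add]
    field_simp
  rw [hphase]
  refine le_trans (le_of_eq ?_) (Complex.re_le_norm _)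
  rw [hsplit, Complex.add_re, Complex.ofReal_re]

theorem le_integral_norm_one_add {r : ℝ} (hr : 0 ≤ r) (hr_one : r ≤ 1) :
    1 + r ^ 2 / 4 + r ^ 4 / 64 ≤ ∫ τ : UnitAddCircle, ‖1 + r * (τ.toCircle : ℂ)‖ := by
  set g : ℂ → ℂ := fun z => r * z - (r * z) ^ 2 / 4 - (r : ℂ) ^ 2 * (r * z) / 8 +
    r * z * (1 / 8 - r * z / 64) * ((r * z) ^ 2 + (r : ℂ) ^ 2 * (r * z) / 2 - (r : ℂ) ^ 4 / 8) /
      sqrtTaylor (r * z) with hg_def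
  have hg : DifferentiableOn ℂ g (Metric.closedBall 0 1) := by
    intro z hz
    have hne : sqrtTaylor (r * z) ≠ 0 := sqrtTaylor_ne_zero (by
      rw [norm_mul, Complex.norm_real, norm_of_nonneg hr]
      exact mul_le_one₀ hr_one (norm_nonneg z) (mem_closedBall_zero_iff.1 hz))
    have hdiff : DifferentiableAt ℂ (fun z : ℂ => sqrtTaylor (r * z)) z := by
      unfold sqrtTaylor
      fun_prop
    exact DifferentiableAt.differentiableWithinAt (by fun_prop (disch := assumption))
  have hpoint (τ : UnitAddCircle) :
      1 + r ^ 2 / 4 + r ^ 4 / 64 + (g τ.toCircle).re ≤ ‖1 + r * (τ.toCircle : ℂ)‖ := by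
    have hnorm : ‖r * (τ.toCircle : ℂ)‖ = r := by
      rw [norm_mul, Circle.norm_coe, Complex.norm_real, norm_of_nonneg hr, mul_one]
    simpa only [hnorm] using le_norm_one_add (hnorm.trans_le hr_one)
  have hg_int : Integrable fun τ : UnitAddCircle => (g τ.toCircle).re :=
    integrable_of_continuous (Complex.continuous_re.comp (continuous_comp_toCircle hg.continuousOn))
  have hmono := integral_mono ((integrable_const _).add hg_int)
    (integrable_of_continuous (by fun_prop)) hpoint
  rw [integral_add' (integrable_const _) hg_int,
    integral_re_toCircle_of_differentiableOn hg] at hmono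
  simpa [hg_def] using hmono

theorem integral_norm_mul_toCircle_add_comm (c w : ℂ) :
    ∫ τ : UnitAddCircle, ‖c * (τ.toCircle : ℂ) + w‖ =
      ∫ τ : UnitAddCircle, ‖w * (τ.toCircle : ℂ) + c‖ := by
  rw [← integral_neg_eq_self]
  refine integral_congr_ae (ae_of_all _ fun τ => ?_)
  have hinv : (τ.toCircle : ℂ) * ((-τ).toCircle : ℂ) = 1 := by
    rw [← Circle.coe_mul, ← AddCircle.toCircle_add, add_neg_cancel, AddCircle.toCircle_zero,
      Circle.coe_one]
  calc ‖c * ((-τ).toCircle : ℂ) + w‖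
      = ‖(τ.toCircle : ℂ) * (c * ((-τ).toCircle : ℂ) + w)‖ := by
        rw [norm_mul, Circle.norm_coe, one_mul]
    _ = ‖w * (τ.toCircle : ℂ) + c‖ := by
        congr 1
        linear_combination c * hinv

theorem integral_norm_mul_toCircle_add {c : ℂ} (hc : c ≠ 0) (w : ℂ) :
    ∫ τ : UnitAddCircle, ‖c * (τ.toCircle : ℂ) + w‖ =
      ‖c‖ * ∫ τ : UnitAddCircle, ‖1 + ((‖w‖ / ‖c‖ : ℝ) : ℂ) * (τ.toCircle : ℂ)‖ := by
  have hfactor (τ : UnitAddCircle) :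
      ‖w * (τ.toCircle : ℂ) + c‖ = ‖c‖ * ‖1 + w / c * (τ.toCircle : ℂ)‖ := by
    rw [← norm_mul]
    congr 1
    field_simp
    ring
  have hnorm : ‖w / c‖ = ‖((‖w‖ / ‖c‖ : ℝ) : ℂ)‖ := by
    rw [Complex.norm_real, norm_div, norm_of_nonneg (by positivity)]
  simp only [integral_norm_mul_toCircle_add_comm c w, hfactor]
  rw [integral_const_mul, integral_comp_const_mul_toCircle (fun z => ‖1 + z‖) hnorm]

-- With denominators cleared, the bound of `le_integral_norm_one_add` for `r⁻¹`, scaled by `r`.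
theorem sixty_four_mul_quartic_le {r : ℝ} (hr : 1 ≤ r) :
    64 * r ^ 3 * (0.98 + 0.29 * r ^ 2 - 0.0065 * r ^ 4) ≤ 64 * r ^ 4 + 16 * r ^ 2 + 1 := by
  rcases le_total r 2 with hr_two | hr_two
  · obtain ⟨y, rfl⟩ : ∃ y, r = 1 + y := ⟨r - 1, by ring⟩
    have hy : 0 ≤ y := by linarith
    have hy_one : 0 ≤ 1 - y := by linarith
    have hcube := mul_nonneg (pow_nonneg hy 3) hy_one
    have hfourth := mul_nonneg (pow_nonneg hy 4) hy_one
    nlinarith [pow_nonneg hy 2, pow_nonneg hy 3, pow_nonneg hy 6, pow_nonneg hy 7]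
  · have hcubic : 0 ≤ 0.0065 * r ^ 3 + 0.0442 * r ^ 2 - 0.06458 * r - 0.04 := by
      nlinarith [pow_nonneg (zero_le_one.trans hr) 3]
    have hquintic : 0 ≤ 0.0065 * r ^ 5 - 0.29 * r ^ 3 + r ^ 2 - 0.98 * r + 0.25 := by
      nlinarith [mul_nonneg hcubic (sq_nonneg (r - 3.4)), sq_nonneg (r - 2.8)]
    nlinarith [mul_nonneg hquintic (sq_nonneg r)]

-- An even quartic can be averaged over a random `r` knowing only its second and fourth moments. The
-- coefficients leave just enough room for `sqrt_pi_div_two_le_mul_quadratic`.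
theorem quartic_le_integral_norm_one_add {r : ℝ} (hr : 0 ≤ r) :
    0.98 + 0.29 * r ^ 2 - 0.0065 * r ^ 4 ≤
      ∫ τ : UnitAddCircle, ‖1 + (r : ℂ) * (τ.toCircle : ℂ)‖ := by
  rcases le_total r 1 with hr_one | hr_one
  · refine le_trans ?_ (le_integral_norm_one_add hr hr_one)
    nlinarith [sq_nonneg (r ^ 2 - 0.9)]
  · have hr_pos : 0 < r := zero_lt_one.trans_le hr_one
    have hinv := le_integral_norm_one_add (inv_nonneg.2 hr) (inv_le_one_of_one_le₀ hr_one)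
    have hswap := integral_norm_mul_toCircle_add (Complex.ofReal_ne_zero.2 hr_pos.ne') 1
    rw [norm_one, Complex.norm_real, norm_of_nonneg hr, one_div] at hswap
    simp only [add_comm (1 : ℂ)] at hinv hswap ⊢
    rw [hswap]
    refine le_trans ?_ (mul_le_mul_of_nonneg_left hinv hr)
    have hclear : r * (1 + r⁻¹ ^ 2 / 4 + r⁻¹ ^ 4 / 64) =
        (64 * r ^ 4 + 16 * r ^ 2 + 1) / (64 * r ^ 3) := by
      field_simp
      ring
    rw [hclear, le_div_iff₀ (by positivity), mul_comm]
    exact sixty_four_mul_quartic_le hr_one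

theorem quartic_le_integral_norm_mul_add {c : ℂ} (hc : c ≠ 0) (w : ℂ) :
    ‖c‖ * (0.98 + 0.29 * (‖w‖ / ‖c‖) ^ 2 - 0.0065 * (‖w‖ / ‖c‖) ^ 4) ≤
      ∫ τ : UnitAddCircle, ‖c * (τ.toCircle : ℂ) + w‖ := by
  rw [integral_norm_mul_toCircle_add hc]
  exact mul_le_mul_of_nonneg_left (quartic_le_integral_norm_one_add (by positivity))
    (norm_nonneg c)

theorem norm_mul_circle_add_sq (c w : ℂ) (z : Circle) : ‖c * (z : ℂ) + w‖ ^ 2 =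
    ‖c‖ ^ 2 + ‖w‖ ^ 2 + 2 * (c * (starRingEnd ℂ) w * z).re := by
  have hexpand := Complex.normSq_add (c * (z : ℂ)) w
  rw [Complex.normSq_mul, Circle.normSq_coe, mul_one, mul_right_comm] at hexpand
  simpa only [Complex.normSq_eq_norm_sq] using hexpand

theorem integral_norm_mul_toCircle_add_sq (c w : ℂ) :
    ∫ τ : UnitAddCircle, ‖c * (τ.toCircle : ℂ) + w‖ ^ 2 = ‖c‖ ^ 2 + ‖w‖ ^ 2 := by
  have hmean := integral_re_toCircle_of_differentiableOn
    (f := fun z => c * (starRingEnd ℂ) w * z) (by fun_prop)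
  simp only [norm_mul_circle_add_sq]
  rw [integral_add (integrable_const _) (integrable_of_continuous (by fun_prop)),
    integral_const_mul, hmean]
  simp

theorem norm_mul_circle_add_pow_four (c w : ℂ) (z : Circle) : ‖c * (z : ℂ) + w‖ ^ 4 =
    ‖c‖ ^ 4 + 4 * ‖c‖ ^ 2 * ‖w‖ ^ 2 + ‖w‖ ^ 4 +
      (((4 * (‖c‖ ^ 2 + ‖w‖ ^ 2) : ℝ) : ℂ) * (c * (starRingEnd ℂ) w * z) +
        ((2 : ℝ) : ℂ) * (c * (starRingEnd ℂ) w * z) ^ 2).re := by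
  have hre (x : ℂ) : x.re ^ 2 = (‖x‖ ^ 2 + (x ^ 2).re) / 2 := by
    rw [← Complex.normSq_eq_norm_sq, Complex.normSq_apply, pow_two x, Complex.mul_re]
    ring
  have hsq := hre (c * (starRingEnd ℂ) w * z)
  rw [norm_mul, norm_mul, RCLike.norm_conj, Circle.norm_coe, mul_one] at hsq
  rw [show 4 = 2 * 2 from rfl, pow_mul, norm_mul_circle_add_sq, Complex.add_re,
    Complex.re_ofReal_mul, Complex.re_ofReal_mul]
  linear_combination 4 * hsq

theorem integral_norm_mul_toCircle_add_pow_four (c w : ℂ) :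
    ∫ τ : UnitAddCircle, ‖c * (τ.toCircle : ℂ) + w‖ ^ 4 =
      ‖c‖ ^ 4 + 4 * ‖c‖ ^ 2 * ‖w‖ ^ 2 + ‖w‖ ^ 4 := by
  have hmean := integral_re_toCircle_of_differentiableOn
    (f := fun z => ((4 * (‖c‖ ^ 2 + ‖w‖ ^ 2) : ℝ) : ℂ) * (c * (starRingEnd ℂ) w * z) +
      ((2 : ℝ) : ℂ) * (c * (starRingEnd ℂ) w * z) ^ 2) (by fun_prop)
  simp only [norm_mul_circle_add_pow_four]
  rw [integral_add (integrable_const _) (integrable_of_continuous (by fun_prop)), hmean]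
  simp

section Moments

variable {ι : Type*} [Fintype ι] (c : ι → ℂ) (s : Finset ι)

theorem integral_norm_sum_sq : ∫ θ : ι → UnitAddCircle,
    ‖∑ k ∈ s, c k * ((θ k).toCircle : ℂ)‖ ^ 2 = ∑ k ∈ s, ‖c k‖ ^ 2 := by
  classical
  induction s using Finset.induction_on with
  | empty => simp
  | insert i s hi ih =>
    rw [integral_comp_sum_insert (f := fun z => ‖z‖ ^ 2) (by fun_prop) c hi]
    simp only [integral_norm_mul_toCircle_add_sq]
    rw [integral_add (integrable_const _) (integrable_of_continuous (by fun_prop)), ih,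
      Finset.sum_insert hi]
    simp

theorem integral_norm_sum_pow_four_le : ∫ θ : ι → UnitAddCircle,
    ‖∑ k ∈ s, c k * ((θ k).toCircle : ℂ)‖ ^ 4 ≤ 2 * (∑ k ∈ s, ‖c k‖ ^ 2) ^ 2 := by
  classical
  induction s using Finset.induction_on with
  | empty => simp
  | insert i s hi ih =>
    rw [integral_comp_sum_insert (f := fun z => ‖z‖ ^ 4) (by fun_prop) c hi]
    simp only [integral_norm_mul_toCircle_add_pow_four]
    rw [integral_add (integrable_of_continuous (by fun_prop))
      (integrable_of_continuous (by fun_prop)), integral_add (integrable_const _)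
      (integrable_of_continuous (by fun_prop)), integral_const_mul, integral_norm_sum_sq,
      Finset.sum_insert hi]
    simp only [integral_const, probReal_univ, smul_eq_mul, one_mul]
    nlinarith [sq_nonneg (‖c i‖ ^ 2)]

end Moments

theorem sqrt_pi_div_two_le_mul_quadratic {a y : ℝ} (ha : 0 ≤ a) (hy : 0 ≤ y) (hy_one : y ≤ 1)
    (hay : a ^ 2 * (1 + y) = 1) : √π / 2 ≤ a * (0.98 + 0.29 * y - 0.013 * y ^ 2) := by
  have hlinear : 0.98 + 0.277 * y ≤ 0.98 + 0.29 * y - 0.013 * y ^ 2 := by nlinarith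
  have hsq : π / 4 * (1 + y) ≤ (0.98 + 0.277 * y) ^ 2 := by nlinarith [pi_lt_d4]
  rw [div_le_iff₀ two_pos, sqrt_le_left (mul_nonneg (mul_nonneg ha (by nlinarith)) two_pos.le)]
  calc π = a ^ 2 * (π / 4 * (1 + y)) * 2 ^ 2 := by linear_combination -π * hay
    _ ≤ a ^ 2 * (0.98 + 0.29 * y - 0.013 * y ^ 2) ^ 2 * 2 ^ 2 := by
        gcongr
        exact hsq.trans (by gcongr)
    _ = _ := by ring

section LargeCoefficient

variable {ι : Type*} [Fintype ι] {c : ι → ℂ}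

theorem mul_quadratic_le_integral_norm_sum_insert [DecidableEq ι] {i : ι} {s : Finset ι}
    (hi : i ∉ s) (hci : c i ≠ 0) :
    ‖c i‖ * (0.98 + 0.29 * ((∑ k ∈ s, ‖c k‖ ^ 2) / ‖c i‖ ^ 2) -
        0.013 * ((∑ k ∈ s, ‖c k‖ ^ 2) / ‖c i‖ ^ 2) ^ 2) ≤
      ∫ θ : ι → UnitAddCircle, ‖∑ k ∈ insert i s, c k * ((θ k).toCircle : ℂ)‖ := by
  set S : (ι → UnitAddCircle) → ℂ := fun θ => ∑ k ∈ s, c k * ((θ k).toCircle : ℂ)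
  have hS_cont : Continuous S := by fun_prop
  have hfourth : 0.0065 * ((∫ θ, ‖S θ‖ ^ 4) / ‖c i‖ ^ 4) ≤
      0.013 * ((∑ k ∈ s, ‖c k‖ ^ 2) / ‖c i‖ ^ 2) ^ 2 := by
    rw [div_pow, ← pow_mul, ← mul_div_assoc, ← mul_div_assoc]
    refine div_le_div_of_nonneg_right ?_ (by positivity)
    linarith [integral_norm_sum_pow_four_le c s]
  rw [integral_comp_sum_insert continuous_norm c hi]
  calc _ ≤ ‖c i‖ * (0.98 + 0.29 * ((∑ k ∈ s, ‖c k‖ ^ 2) / ‖c i‖ ^ 2) -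
          0.0065 * ((∫ θ, ‖S θ‖ ^ 4) / ‖c i‖ ^ 4)) := by gcongr
    _ = ∫ θ, ‖c i‖ * (0.98 + 0.29 * (‖S θ‖ / ‖c i‖) ^ 2 - 0.0065 * (‖S θ‖ / ‖c i‖) ^ 4) := by
        simp only [div_pow]
        rw [integral_const_mul, integral_sub (integrable_of_continuous (by fun_prop))
          (integrable_of_continuous (by fun_prop)), integral_add (integrable_const _)
          (integrable_of_continuous (by fun_prop)), integral_const_mul, integral_const_mul,
          integral_div, integral_div, integral_norm_sum_sq]
        simp only [integral_const, probReal_univ, smul_eq_mul, one_mul]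
    _ ≤ ∫ θ, ∫ σ : UnitAddCircle, ‖c i * (σ.toCircle : ℂ) + S θ‖ :=
        integral_mono (integrable_of_continuous (by fun_prop))
          (integrable_of_continuous (X := (ι → UnitAddCircle) × UnitAddCircle)
            (f := fun p => ‖c i * (p.2.toCircle : ℂ) + S p.1‖) (by fun_prop)).integral_prod_left
          fun θ => quartic_le_integral_norm_mul_add hci _

theorem sqrt_pi_div_two_le_of_large (hsum : ∑ k, ‖c k‖ ^ 2 = 1) {i : ι}
    (hi : 1 / 2 ≤ ‖c i‖ ^ 2) :
    √π / 2 ≤ ∫ θ : ι → UnitAddCircle, ‖∑ k, c k * ((θ k).toCircle : ℂ)‖ := by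
  classical
  have hci : c i ≠ 0 := by
    rintro h
    norm_num [h] at hi
  have hbound := mul_quadratic_le_integral_norm_sum_insert (Finset.notMem_erase i Finset.univ) hci
  rw [Finset.insert_erase (Finset.mem_univ i)] at hbound
  rw [← Finset.add_sum_erase _ _ (Finset.mem_univ i)] at hsum
  have hpos : 0 < ‖c i‖ ^ 2 := by linarith
  refine (sqrt_pi_div_two_le_mul_quadratic (norm_nonneg _) (by positivity) ?_ ?_).trans hbound
  · rw [div_le_one hpos]
    linarith
  · field_simp
    exact hsum

end LargeCoefficient

section Khinchin

variable {ι κ : Type*} [Fintype ι] [Fintype κ]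

theorem khinchin_steinhaus (c : ι → ℂ) :
    √π / 2 * √(∑ k, ‖c k‖ ^ 2) ≤
      ∫ θ : ι → UnitAddCircle, ‖∑ k, c k * ((θ k).toCircle : ℂ)‖ := by
  set σ := √(∑ k, ‖c k‖ ^ 2) with hσ
  rcases (sqrt_nonneg _ : 0 ≤ σ).eq_or_lt with hzero | hpos
  · rw [hσ, ← hzero, mul_zero]
    positivity
  have hσ_norm : ‖(σ : ℂ)‖ = σ := by rw [Complex.norm_real, norm_of_nonneg hpos.le]
  have hsum : ∑ k, ‖c k / σ‖ ^ 2 = 1 := by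
    simp only [norm_div, hσ_norm, div_pow]
    rw [← Finset.sum_div, ← sq_sqrt (by positivity : 0 ≤ ∑ k, ‖c k‖ ^ 2), ← hσ,
      div_self (by positivity)]
  have hnormalized : √π / 2 ≤
      ∫ θ : ι → UnitAddCircle, ‖∑ k, c k / σ * ((θ k).toCircle : ℂ)‖ := by
    by_cases hsmall : ∀ k, ‖c k / σ‖ ^ 2 ≤ 1 / 2
    · exact sqrt_pi_div_two_le_of_small hsum hsmall
    · push Not at hsmall
      obtain ⟨i, hi⟩ := hsmall
      exact sqrt_pi_div_two_le_of_large hsum hi.le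
  simp only [div_mul_eq_mul_div (c _), ← Finset.sum_div, norm_div, hσ_norm,
    integral_div] at hnormalized
  exact (le_div_iff₀ hpos).1 hnormalized

theorem khinchin_steinhaus_l2 (c : κ → ι → ℂ) :
    √π / 2 * √(∑ j, ∑ k, ‖c j k‖ ^ 2) ≤
      ∫ θ : ι → UnitAddCircle, √(∑ j, ‖∑ k, c j k * ((θ k).toCircle : ℂ)‖ ^ 2) := by
  set V : (ι → UnitAddCircle) → EuclideanSpace ℝ κ := fun θ =>
    WithLp.toLp 2 fun j => ‖∑ k, c j k * ((θ k).toCircle : ℂ)‖ with hV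
  have hV_int : Integrable V :=
    (by fun_prop : Continuous V).integrable_of_hasCompactSupport (.of_compactSpace V)
  have hV_norm (θ : ι → UnitAddCircle) :
      ‖V θ‖ = √(∑ j, ‖∑ k, c j k * ((θ k).toCircle : ℂ)‖ ^ 2) := by
    rw [EuclideanSpace.norm_eq]
    simp only [hV, norm_norm]
  have hV_coord (j : κ) : (∫ θ, V θ) j =
      ∫ θ : ι → UnitAddCircle, ‖∑ k, c j k * ((θ k).toCircle : ℂ)‖ :=
    ((EuclideanSpace.proj (𝕜 := ℝ) j).integral_comp_comm hV_int).symm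
  simp only [← hV_norm]
  refine le_trans ?_ (norm_integral_le_integral_norm V)
  rw [EuclideanSpace.norm_eq]
  apply le_sqrt_of_sq_le
  rw [mul_pow, sq_sqrt (by positivity), Finset.mul_sum]
  refine Finset.sum_le_sum fun j _ => ?_
  rw [hV_coord, norm_of_nonneg (by positivity), ← sq_sqrt (by positivity : 0 ≤ ∑ k, ‖c j k‖ ^ 2),
    ← mul_pow]
  gcongr
  exact khinchin_steinhaus (c j)

theorem exists_circle_sum_sqrt_le {α : Type*} [Fintype α] (c : α → κ → ι → ℂ) :
    ∃ z : ι → Circle, √π / 2 * ∑ i, √(∑ j, ∑ k, ‖c i j k‖ ^ 2) ≤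
      ∑ i, √(∑ j, ‖∑ k, c i j k * (z k : ℂ)‖ ^ 2) := by
  have hint (i : α) : Integrable fun θ : ι → UnitAddCircle =>
      √(∑ j, ‖∑ k, c i j k * ((θ k).toCircle : ℂ)‖ ^ 2) :=
    integrable_of_continuous (by fun_prop)
  obtain ⟨θ, hθ⟩ := exists_integral_le (integrable_finsetSum Finset.univ fun i _ => hint i)
  refine ⟨fun k => (θ k).toCircle, le_trans ?_ hθ⟩
  rw [integral_finsetSum _ fun i _ => hint i, Finset.mul_sum]
  exact Finset.sum_le_sum fun i _ => khinchin_steinhaus_l2 (c i)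

end Khinchin

/-! ### Lower bound for the value of a pattern -/

theorem sum_eq_sum_insertNth {m : ℕ} {n : Fin (m + 1) → ℕ} {M : Type*} [AddCommMonoid M]
    (p : Fin (m + 1)) (f : ((k : Fin (m + 1)) → Fin (n k)) → M) :
    ∑ j, f j = ∑ i, ∑ j : (k : Fin m) → Fin (n (p.succAbove k)), f (p.insertNth i j) := by
  rw [← Fintype.sum_prod_type', ← (Fin.insertNthEquiv (fun k => Fin (n k)) p).sum_comp]
  rfl

/-- The value at `x` of the multilinear form with arbitrary complex coefficients `c`. Patterns have
unimodular coefficients, which is not preserved when some of the knobs are fixed. -/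
noncomputable def evalForm {m : ℕ} {n : Fin m → ℕ} (c : ((k : Fin m) → Fin (n k)) → ℂ)
    (x : Knobs n) : ℂ :=
  ∑ j, c j * ∏ k, (x k (j k) : ℂ)

section EvalForm

variable {m : ℕ}

theorem total_eq_evalForm {n : Fin m → ℕ} (a : Pattern n) (x : Knobs n) :
    total a x = evalForm (fun j => (a j : ℂ)) x :=
  rfl

theorem evalForm_of_zero_directions {n : Fin 0 → ℕ} (c : ((k : Fin 0) → Fin (n k)) → ℂ)
    (x : Knobs n) : evalForm c x = c default := by
  simp [evalForm]

theorem evalForm_sum_mul {n : Fin m → ℕ} {κ : Type*} [Fintype κ]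
    (c : κ → ((k : Fin m) → Fin (n k)) → ℂ) (z : κ → ℂ) (x : Knobs n) :
    evalForm (fun j => ∑ l, c l j * z l) x = ∑ l, z l * evalForm (c l) x := by
  simp only [evalForm, Finset.sum_mul, Finset.mul_sum]
  rw [Finset.sum_comm]
  exact Finset.sum_congr rfl fun l _ => Finset.sum_congr rfl fun j _ => by ring

theorem evalForm_eq_sum_slices {n : Fin (m + 1) → ℕ} (p : Fin (m + 1))
    (c : ((k : Fin (m + 1)) → Fin (n k)) → ℂ) (x : Knobs n) :
    evalForm c x = ∑ i, (x p i : ℂ) *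
      evalForm (fun j => c (p.insertNth i j)) (fun k => x (p.succAbove k)) := by
  simp only [evalForm, Finset.mul_sum]
  rw [sum_eq_sum_insertNth p]
  refine Finset.sum_congr rfl fun i _ => Finset.sum_congr rfl fun j _ => ?_
  simp only [Fin.prod_univ_succAbove _ p, Fin.insertNth_apply_same, Fin.insertNth_apply_succAbove]
  ring

end EvalForm

theorem exists_knobs_le_sum_norm_evalForm {ι : Type*} [Fintype ι] {m : ℕ} {n : Fin m → ℕ}
    (c : ι → ((k : Fin m) → Fin (n k)) → ℂ) : ∃ x : Knobs n,
      (√π / 2) ^ m * ∑ i, √(∑ j, ‖c i j‖ ^ 2) ≤ ∑ i, ‖evalForm (c i) x‖ := by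
  induction m with
  | zero => exact ⟨fun k => k.elim0, by simp [evalForm_of_zero_directions, sqrt_sq]⟩
  | succ m ih =>
    obtain ⟨z, hz⟩ := exists_circle_sum_sqrt_le
      fun i (j : (k : Fin m) → Fin (n (Fin.succAbove 0 k))) (l : Fin (n 0)) =>
        c i (Fin.insertNth 0 l j)
    obtain ⟨x, hx⟩ := ih fun i (j : (k : Fin m) → Fin (n (Fin.succAbove 0 k))) =>
      ∑ l : Fin (n 0), c i (Fin.insertNth 0 l j) * (z l : ℂ)
    refine ⟨Fin.insertNth (α := fun k => Fin (n k) → Circle) 0 z x, ?_⟩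
    simp only [evalForm_eq_sum_slices 0 (c _), Fin.insertNth_apply_same,
      Fin.insertNth_apply_succAbove, ← evalForm_sum_mul]
    calc (√π / 2) ^ (m + 1) * ∑ i, √(∑ j, ‖c i j‖ ^ 2)
        = (√π / 2) ^ m * (√π / 2 * ∑ i,
            √(∑ j : (k : Fin m) → Fin (n (Fin.succAbove 0 k)),
              ∑ l : Fin (n 0), ‖c i (Fin.insertNth 0 l j)‖ ^ 2)) := by
          simp only [sum_eq_sum_insertNth (n := n) 0]
          rw [pow_succ, mul_assoc]
          simp only [Finset.sum_comm (s := (Finset.univ : Finset (Fin (n 0))))]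
      _ ≤ _ := (mul_le_mul_of_nonneg_left hz (by positivity)).trans hx

section PatternValue

variable {m : ℕ} {n : Fin m → ℕ} (a : Pattern n)

theorem norm_total_le_patternValue (x : Knobs n) : ‖total a x‖ ≤ patternValue a :=
  le_ciSup (f := fun x => ‖total a x‖)
    (isCompact_range (by unfold total; fun_prop)).bddAbove x

theorem patternValue_nonneg : 0 ≤ patternValue a :=
  Real.iSup_nonneg fun _ => norm_nonneg _

end PatternValue

theorem exists_circle_mul_eq_norm (w : ℂ) : ∃ u : Circle, (u * w : ℂ) = ‖w‖ := by
  obtain ⟨u, hu⟩ := exists_eq_mul_circle_of_norm_eq (c := (‖w‖ : ℂ)) (d := w) (by simp)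
  exact ⟨u, by rw [mul_comm, ← hu]⟩

theorem le_patternValue {m : ℕ} {n : Fin (m + 1) → ℕ} (a : Pattern n) (p : Fin (m + 1)) :
    (√π / 2) ^ m * (√(∏ k, (n k : ℝ)) * √(n p : ℝ)) ≤ patternValue a := by
  obtain ⟨x, hx⟩ := exists_knobs_le_sum_norm_evalForm
    fun (i : Fin (n p)) (j : (k : Fin m) → Fin (n (p.succAbove k))) => (a (p.insertNth i j) : ℂ)
  choose u hu using fun i : Fin (n p) => exists_circle_mul_eq_norm
    (evalForm (fun j : (k : Fin m) → Fin (n (p.succAbove k)) => (a (p.insertNth i j) : ℂ)) x)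
  have hsize : ∑ i : Fin (n p), √(∑ j : (k : Fin m) → Fin (n (p.succAbove k)),
      ‖(a (p.insertNth i j) : ℂ)‖ ^ 2) = √(∏ k, (n k : ℝ)) * √(n p : ℝ) := by
    simp only [Circle.norm_coe, one_pow, Finset.sum_const, Finset.card_univ, Fintype.card_fin,
      Fintype.card_pi, nsmul_eq_mul, mul_one, Nat.cast_prod]
    rw [Fin.prod_univ_succAbove _ p, sqrt_mul (Nat.cast_nonneg _), mul_right_comm,
      mul_self_sqrt (Nat.cast_nonneg _)]
  calc _ ≤ ∑ i : Fin (n p), ‖evalForm (fun j => (a (p.insertNth i j) : ℂ)) x‖ := hsize ▸ hx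
    _ = ‖total a (Fin.insertNth (α := fun k => Fin (n k) → Circle) p u x)‖ := by
        rw [total_eq_evalForm, evalForm_eq_sum_slices p]
        simp only [Fin.insertNth_apply_same, Fin.insertNth_apply_succAbove, hu]
        rw [← Complex.ofReal_sum, Complex.norm_real, norm_of_nonneg (by positivity)]
    _ ≤ patternValue a := norm_total_le_patternValue a _

/-! ### Norm of the multilinear form -/

section FormNorm

variable {m : ℕ} {n : Fin m → ℕ} (a : Pattern n)

theorem exists_circle_add_circle_eq {z : ℂ} (hz : ‖z‖ ≤ 1) :
    ∃ u v : Circle, (u : ℂ) + v = 2 * z := by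
  refine ⟨Circle.exp (z.arg + arccos ‖z‖), Circle.exp (z.arg - arccos ‖z‖), ?_⟩
  have hcos : (2 : ℂ) * ‖z‖ = Complex.exp (arccos ‖z‖ * Complex.I) +
      Complex.exp (-arccos ‖z‖ * Complex.I) := by
    rw [← Complex.two_cos, ← Complex.ofReal_cos, cos_arccos (by linarith [norm_nonneg z]) hz]
  rw [Circle.coe_exp, Circle.coe_exp]
  push_cast
  rw [sub_eq_add_neg, add_mul, add_mul, Complex.exp_add, Complex.exp_add, ← mul_add, ← hcos]
  nth_rewrite 3 [← Complex.norm_mul_exp_arg_mul_I z]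
  ring

theorem form_coe (x : Knobs n) : form a (fun k i => (x k i : ℂ)) = total a x := by
  rw [form_apply, total]

-- Every entry of `2 • y` is a sum of two unimodular numbers, so that `2 ^ m • form a y` is a sum of
-- `2 ^ m` values of `form a` at unimodular arguments.
theorem norm_form_apply_le_patternValue {y : (k : Fin m) → Fin (n k) → ℂ}
    (hy : ∀ k i, ‖y k i‖ ≤ 1) : ‖form a y‖ ≤ patternValue a := by
  choose u v huv using fun k i => exists_circle_add_circle_eq (hy k i)
  have hcorner (s : Finset (Fin m)) : ‖form a (s.piecewise (fun k i => (u k i : ℂ))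
      fun k i => (v k i : ℂ))‖ ≤ patternValue a := by
    have hunit : s.piecewise (fun k i => (u k i : ℂ)) (fun k i => (v k i : ℂ)) =
        fun k i => ((s.piecewise u v k i : Circle) : ℂ) := by
      funext k i
      by_cases hk : k ∈ s <;> simp [hk]
    rw [hunit, form_coe]
    exact norm_total_le_patternValue a _
  have hdouble : (fun k i => (u k i : ℂ)) + (fun k i => (v k i : ℂ)) =
      fun k => (2 : ℂ) • y k := by
    funext k i
    exact huv k i
  have hexpand : (2 : ℂ) ^ m * form a y = ∑ s : Finset (Fin m),
      form a (s.piecewise (fun k i => (u k i : ℂ)) fun k i => (v k i : ℂ)) := by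
    rw [← ContinuousMultilinearMap.map_add_univ, hdouble, ContinuousMultilinearMap.map_smul_univ]
    simp
  refine le_of_mul_le_mul_left ?_ (by positivity : (0 : ℝ) < 2 ^ m)
  calc (2 : ℝ) ^ m * ‖form a y‖ = ‖(2 : ℂ) ^ m * form a y‖ := by simp
    _ ≤ ∑ _s : Finset (Fin m), patternValue a := by
        rw [hexpand]
        exact norm_sum_le_of_le _ fun s _ => hcorner s
    _ = 2 ^ m * patternValue a := by simp

theorem norm_form : ‖form a‖ = patternValue a := by
  apply le_antisymm
  · refine ContinuousMultilinearMap.opNorm_le_bound (patternValue_nonneg a) fun x => ?_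
    have hx : x = fun k => (‖x k‖ : ℂ) • ((‖x k‖⁻¹ : ℝ) : ℂ) • x k := by
      funext k
      rcases eq_or_ne (x k) 0 with hk | hk
      · simp [hk]
      · rw [smul_smul, ← Complex.ofReal_mul, mul_inv_cancel₀ (norm_ne_zero_iff.2 hk)]
        simp
    rw [hx, ContinuousMultilinearMap.map_smul_univ, norm_smul, ← hx, mul_comm]
    have hunit := norm_form_apply_le_patternValue a (y := fun k => ((‖x k‖⁻¹ : ℝ) : ℂ) • x k)
      fun k i => by
        rw [Pi.smul_apply, norm_smul, Complex.norm_real, norm_inv, norm_norm]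
        exact inv_mul_le_one_of_le₀ (norm_le_pi_norm (x k) i) (norm_nonneg _)
    refine mul_le_mul hunit (le_of_eq ?_) (norm_nonneg _) (patternValue_nonneg a)
    simp
  · refine ciSup_le fun x => ?_
    rw [← form_coe]
    refine (form a).unit_le_opNorm ?_
    exact (pi_norm_le_iff_of_nonneg zero_le_one).2 fun k =>
      (pi_norm_le_iff_of_nonneg zero_le_one).2 fun i => (Circle.norm_coe _).le

theorem continuous_patternValue : Continuous fun a : Pattern n => patternValue a := by
  simp only [← norm_form]
  unfold form
  fun_prop

theorem isLeast_patternValue (n : Fin m → ℕ) :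
    IsLeast (Set.range fun a : Pattern n => patternValue a) (gameValue n) :=
  (isCompact_range continuous_patternValue).isLeast_sInf (Set.range_nonempty _)

end FormNorm

/-! ### Upper bound by Fourier matrices -/

theorem sum_norm_sq_addChar_mul {R κ : Type*} [CommRing R] [Fintype R] [Fintype κ]
    {ψ : AddChar R ℂ} (hψ : ψ.IsPrimitive) {f : κ → R} (hf : Function.Injective f) (b : κ → ℂ) :
    ∑ r, ‖∑ l, ψ (r * f l) * b l‖ ^ 2 = Fintype.card R * ∑ l, ‖b l‖ ^ 2 := by
  classical
  have horth (l l' : κ) : ∑ r, ψ (r * f l) * (starRingEnd ℂ) (ψ (r * f l')) =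
      if l = l' then (Fintype.card R : ℂ) else 0 := by
    simp only [← AddChar.map_neg_eq_conj, ← AddChar.map_add_eq_mul, ← mul_neg, ← mul_add,
      ← sub_eq_add_neg]
    rw [AddChar.sum_mulShift _ hψ]
    simp only [sub_eq_zero, hf.eq_iff, Nat.cast_ite, Nat.cast_zero]
  rw [← Complex.ofReal_inj]
  push_cast
  simp only [← Complex.mul_conj', map_sum, map_mul, Finset.sum_mul_sum]
  calc ∑ r, ∑ l, ∑ l', ψ (r * f l) * b l *
        ((starRingEnd ℂ) (ψ (r * f l')) * (starRingEnd ℂ) (b l'))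
      = ∑ l, ∑ l', (∑ r, ψ (r * f l) * (starRingEnd ℂ) (ψ (r * f l'))) *
          (b l * (starRingEnd ℂ) (b l')) := by
        rw [Finset.sum_comm]
        refine Finset.sum_congr rfl fun l _ => ?_
        rw [Finset.sum_comm]
        refine Finset.sum_congr rfl fun l' _ => ?_
        rw [Finset.sum_mul]
        exact Finset.sum_congr rfl fun r _ => by ring
    _ = _ := by simp [horth, Finset.mul_sum]

theorem exists_circle_matrix_sum_norm_sq_eq {L N : ℕ} (hLN : L ≤ N) :
    ∃ U : Fin N → Fin L → Circle, ∀ b : Fin L → ℂ,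
      ∑ i, ‖∑ l, (U i l : ℂ) * b l‖ ^ 2 = N * ∑ l, ‖b l‖ ^ 2 := by
  rcases N.eq_zero_or_pos with rfl | hN
  · exact ⟨fun i => i.elim0, by simp⟩
  have : NeZero N := ⟨hN.ne'⟩
  let e := (ZMod.finEquiv N).toEquiv
  refine ⟨fun i l => ZMod.toCircle (e i * e (l.castLE hLN)), fun b => ?_⟩
  rw [e.sum_comp fun r => ‖∑ l, (ZMod.toCircle (r * e (l.castLE hLN)) : ℂ) * b l‖ ^ 2]
  simpa only [ZMod.stdAddChar_apply, ZMod.card, Function.comp_apply] using sum_norm_sq_addChar_mul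
    (ZMod.isPrimitive_stdAddChar N) (e.injective.comp (Fin.castLE_injective hLN)) b

-- From the longest direction on, the pattern is a product of Fourier matrices which couple each
-- direction to the next longest one, so that every step is isometric up to scaling.
theorem exists_pattern_sum_norm_sq_slices_eq {m : ℕ} (n : Fin (m + 1) → ℕ) {p : Fin (m + 1)}
    (hp : ∀ k, n k ≤ n p) : ∃ a : Pattern n, ∀ x : Knobs fun k => n (p.succAbove k),
      ∑ i : Fin (n p), ‖evalForm (fun j => (a (p.insertNth i j) : ℂ)) x‖ ^ 2 =
        ∏ k, (n k : ℝ) := by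
  induction m with
  | zero =>
    obtain rfl : p = 0 := Fin.fin_one_eq_zero p
    refine ⟨fun _ => 1, fun x => ?_⟩
    have hone : evalForm (fun _ => ((1 : Circle) : ℂ)) x = 1 :=
      (evalForm_of_zero_directions _ x).trans Circle.coe_one
    calc ∑ _i : Fin (n 0), ‖evalForm (fun _ => ((1 : Circle) : ℂ)) x‖ ^ 2
        = ∑ _i : Fin (n 0), (1 : ℝ) := by rw [hone, norm_one, one_pow]
      _ = ∏ k, (n k : ℝ) := by simp
  | succ m ih =>
    obtain ⟨q, hq⟩ := Finite.exists_max fun k => n (p.succAbove k)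
    obtain ⟨a, ha⟩ := ih (fun k => n (p.succAbove k)) hq
    obtain ⟨U, hU⟩ := exists_circle_matrix_sum_norm_sq_eq (hp (p.succAbove q))
    refine ⟨fun j => U (j p) (j (p.succAbove q)) * a (fun k => j (p.succAbove k)), fun x => ?_⟩
    have hslice (i : Fin (n p)) (l : Fin (n (p.succAbove q))) :
        evalForm (fun j => ((U i l * a (q.insertNth l j) : Circle) : ℂ))
          (fun k => x (q.succAbove k)) =
        U i l * evalForm (fun j => (a (q.insertNth l j) : ℂ)) (fun k => x (q.succAbove k)) := by
      simp only [evalForm, Finset.mul_sum, Circle.coe_mul, mul_assoc]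
    simp only [Fin.insertNth_apply_same, Fin.insertNth_apply_succAbove,
      evalForm_eq_sum_slices q, hslice, mul_left_comm (x q _ : ℂ)]
    rw [hU, Fin.prod_univ_succAbove _ p, ← ha fun k => x (q.succAbove k)]
    simp only [norm_mul, Circle.norm_coe, one_mul]

theorem exists_pattern_patternValue_le {m : ℕ} (n : Fin (m + 1) → ℕ) {p : Fin (m + 1)}
    (hp : ∀ k, n k ≤ n p) :
    ∃ a : Pattern n, patternValue a ≤ √(∏ k, (n k : ℝ)) * √(n p : ℝ) := by
  obtain ⟨a, ha⟩ := exists_pattern_sum_norm_sq_slices_eq n hp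
  refine ⟨a, ciSup_le fun x => ?_⟩
  set y : Fin (n p) → ℂ := fun i =>
    evalForm (fun j => (a (p.insertNth i j) : ℂ)) (fun k => x (p.succAbove k))
  have hcauchy := sq_sum_le_card_mul_sum_sq (s := Finset.univ) (f := fun i => ‖y i‖)
  rw [ha, Finset.card_univ, Fintype.card_fin, mul_comm] at hcauchy
  calc ‖total a x‖ ≤ ∑ i, ‖y i‖ := by
        rw [total_eq_evalForm, evalForm_eq_sum_slices p]
        exact norm_sum_le_of_le _ fun i _ => by rw [norm_mul, Circle.norm_coe, one_mul]
    _ ≤ √((∏ k, (n k : ℝ)) * n p) := le_sqrt_of_sq_le hcauchy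
    _ = _ := sqrt_mul (by positivity) _

section Ratio

variable {m : ℕ} {n : Fin (m + 1) → ℕ}

theorem ratio_eq_of_forall_le {p : Fin (m + 1)} (hp : ∀ k, n k ≤ n p) :
    ratio n = gameValue n / (√(∏ k, (n k : ℝ)) * √(n p : ℝ)) := by
  have hmax : IsGreatest (Set.range fun k => √(n k : ℝ)) √(n p : ℝ) :=
    ⟨⟨p, rfl⟩, by rintro _ ⟨k, rfl⟩; exact sqrt_le_sqrt (Nat.cast_le.2 (hp k))⟩
  rw [ratio, iSup, hmax.csSup_eq]

theorem ratio_denom_pos (hn : ∀ k, 1 ≤ n k) (p : Fin (m + 1)) :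
    0 < √(∏ k, (n k : ℝ)) * √(n p : ℝ) := by
  have hpos (k : Fin (m + 1)) : (0 : ℝ) < n k := Nat.cast_pos.2 (hn k)
  exact mul_pos (sqrt_pos.2 (Finset.prod_pos fun k _ => hpos k)) (sqrt_pos.2 (hpos p))

theorem ratio_le_one : ratio n ≤ 1 := by
  obtain ⟨p, hp⟩ := Finite.exists_max n
  obtain ⟨a, ha⟩ := exists_pattern_patternValue_le n hp
  rw [ratio_eq_of_forall_le hp]
  exact div_le_one_of_le₀ (((isLeast_patternValue n).2 ⟨a, rfl⟩).trans ha) (by positivity)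

theorem le_ratio (hn : ∀ k, 1 ≤ n k) : (√π / 2) ^ m ≤ ratio n := by
  obtain ⟨p, hp⟩ := Finite.exists_max n
  obtain ⟨a, ha⟩ := (isLeast_patternValue n).1
  rw [ratio_eq_of_forall_le hp, le_div_iff₀ (ratio_denom_pos hn p), ← ha]
  exact le_patternValue a p

theorem ratio_one : ratio (fun _ : Fin (m + 1) => 1) = 1 := by
  obtain ⟨a, ha⟩ := (isLeast_patternValue (fun _ : Fin (m + 1) => 1)).1
  have htotal (x : Knobs fun _ : Fin (m + 1) => 1) : ‖total a x‖ = 1 := by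
    rw [total, Fintype.sum_unique, norm_mul, norm_prod]
    simp only [Circle.norm_coe, Finset.prod_const_one, mul_one]
  have hvalue : patternValue a = 1 := by
    simp only [patternValue, htotal, ciSup_const]
  rw [ratio, ← ha]
  simp [hvalue]

end Ratio

end SwitchingGame

theorem theorem1p4 (m : ℕ) (hm : 2 ≤ m) :
    (∀ n : Fin m → ℕ, (∀ k, 1 ≤ n k) →
      IsLeast (Set.range fun a : SwitchingGame.Pattern n => SwitchingGame.patternValue a)
        (SwitchingGame.gameValue n) ∧
      IsLeast (Set.range fun a : SwitchingGame.Pattern n => ‖SwitchingGame.form a‖)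
        (SwitchingGame.gameValue n) ∧
      (√Real.pi / 2) ^ (m - 1) ≤ SwitchingGame.ratio n ∧
      SwitchingGame.ratio n ≤ 1) ∧
    (∀ C : ℝ, (∀ n : Fin m → ℕ, (∀ k, 1 ≤ n k) → SwitchingGame.ratio n ≤ C) → 1 ≤ C) := by
  obtain ⟨m, rfl⟩ : ∃ l, m = l + 1 := ⟨m - 1, by omega⟩
  refine ⟨fun n hn => ⟨SwitchingGame.isLeast_patternValue n, ?_, SwitchingGame.le_ratio hn,
    SwitchingGame.ratio_le_one⟩, fun C hC => ?_⟩
  · simp only [SwitchingGame.norm_form]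
    exact SwitchingGame.isLeast_patternValue n
  · rw [← SwitchingGame.ratio_one (m := m)]
    exact hC _ fun _ => le_rfl
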